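/- Let $A\subseteq\mathbb{R}^N$ be open and $u_0\in L^2(A;\mathbb{R}^N)$. For $u\in L^2(A;\mathbb{R}^N)$ let \[ \mathcal{D}(u)=\sup\Big\{-\int_A u\cdot\nabla\varphi\,dx\ :\ \varphi\in C_c^\infty(A),\ |\varphi|\le 1\Big\}\in[0,+\infty] \] (the total mass of the distribution $\operatorname{div}u$, written $\int_A|\operatorname{div}u|$), and let $\partial\mathcal{D}$ be its subgradient in the Hilbert space $L^2(A;\mathbb{R}^N)$. The $L^2$-gradient flow of $\mathcal{D}$ starting from $u_0$ is the map $u:[0,\infty)\to L^2(A;\mathbb{R}^N)$ which is continuous, absolutely continuous on every compact subinterval of $(0,\infty)$, and satisfies $u(0)=u_0$ and $-u_t(t)\in\partial\mathcal{D}(u(t))$ for a.e. $t>0$. Then: (a) The gradient flow $u$ exists, and for every $t>0$, $u(t)$ is the unique minimizer over $L^2(A;\mathbb{R}^N)$ of \[ z\ \longmapsto\ \int_A|\operatorname{div}z|+\frac1{2t}\int_A|z-u_0|^2\,dx . \] (b) Assume moreover that the Poincaré inequality holds on $A$, i.e. there is a constant $C$ with $\int_A\varphi^2\le C\int_A|\nabla\varphi|^2$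 for all $\varphi\in C_c^\infty(A)$ (for instance $N\ge1$ and $A$ bounded). Then there is a function $v(t,x)$, measurable on $(0,\infty)\times A$, such that for a.e. $t>0$ \[ v(t)\in H^1_0(A),\qquad |v(t)|\le1\ \text{a.e. in }A,\qquad u_t(t)=\nabla v(t),\qquad \mathcal{D}(u(t))+\int_A u(t)\cdot\nabla v(t)\,dx=0 . \] For every such $v$, let $w(t,x)=\int_0^t v(s,x)\,ds$. Then for every $t\ge0$ one has $w(t)\in H^1_0(A)$, $|w(t)|\le t$ a.e. in $A$, $u(t)=u_0+\nabla w(t)$, and $w(t)$ solves the obstacle problem \[ \min\Big\{\frac12\int_A|u_0+\nabla w|^2\,dx\ :\ w\in H^1_0(A),\ |w|\le t\ \text{a.e. in }A\Big\}. \] -/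

import Mathlib

open MeasureTheory Set Filter Topology
open scoped ContDiff

noncomputable section

namespace DivFlow

/-- Euclidean space `ℝ^N`. -/
abbrev Euc (N : ℕ) := EuclideanSpace ℝ (Fin N)

/-- The space `L²(A)` of real functions. -/
abbrev L2 {N : ℕ} (A : Set (Euc N)) := Lp ℝ 2 (volume.restrict A)

/-- The Hilbert space `L²(A; ℝ^N)` of vector fields. -/
abbrev L2Vec {N : ℕ} (A : Set (Euc N)) := Lp (Euc N) 2 (volume.restrict A)

/-- `φ ∈ C_c^∞(A)`. -/
def IsTest {N : ℕ} (A : Set (Euc N)) (φ : Euc N → ℝ) : Prop :=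
  ContDiff ℝ ∞ φ ∧ HasCompactSupport φ ∧ tsupport φ ⊆ A

/-- The total mass of the distributional divergence,
`𝒟(u) = sup { ∫_A -u · ∇φ : φ ∈ C_c^∞(A), |φ| ≤ 1 }`, with values in `[0, +∞]`. -/
def divMass {N : ℕ} (A : Set (Euc N)) (u : L2Vec A) : EReal :=
  ⨆ φ ∈ {φ : Euc N → ℝ | IsTest A φ ∧ ∀ x, |φ x| ≤ 1},
    ((∫ x in A, -inner ℝ (u x) (gradient φ x) : ℝ) : EReal)

/-- The subgradient `∂𝒟(u)` in the Hilbert space `L²(A; ℝ^N)`. It is empty where `𝒟(u) = +∞`,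
because `𝒟(0) = 0`. -/
def subgrad {N : ℕ} (A : Set (Euc N)) (u : L2Vec A) : Set (L2Vec A) :=
  {p | ∀ z : L2Vec A, divMass A u + ((inner ℝ p (z - u) : ℝ) : EReal) ≤ divMass A z}

/-- `u` is the `L²`-gradient flow of `𝒟` starting from `u₀`, that is the strong solution of
`u_t ∈ -∂𝒟(u)`, `u(0) = u₀`: continuous on `[0, ∞)`, absolutely continuous on the compact
subintervals of `(0, ∞)`, with the inclusion holding for almost every `t > 0`.
Only the values `u t` with `0 ≤ t` matter. -/
structure IsGradientFlow {N : ℕ} (A : Set (Euc N)) (u₀ : L2Vec A) (u : ℝ → L2Vec A) : Prop where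
  initial : u 0 = u₀
  continuousOn : ContinuousOn u (Ici 0)
  absCont : ∀ a b : ℝ, 0 < a → a ≤ b → AbsolutelyContinuousOnInterval u a b
  inclusion : ∀ᵐ t ∂(volume.restrict (Ioi (0 : ℝ))), ∃ p ∈ subgrad A (u t), HasDerivAt u (-p) t

/-- The graph `φ ↦ (φ, ∇φ)` of the gradient on `C_c^∞(A)`, inside `L²(A) × L²(A; ℝ^N)`. -/
def testGraph {N : ℕ} (A : Set (Euc N)) : Set (L2 A × L2Vec A) :=
  {q | ∃ φ, IsTest A φ ∧ q.1 =ᵐ[volume.restrict A] φ ∧ q.2 =ᵐ[volume.restrict A] gradient φ}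

/-- `w ∈ H^1_0(A)` and `∇w = g`: the space `H^1_0(A)` is the closure of `C_c^∞(A)` for the norm
`(‖w‖² + ‖∇w‖²)^{1/2}`, and `g` is the limit of the gradients, which is the weak gradient of `w`. -/
def HasGradH10 {N : ℕ} (A : Set (Euc N)) (w : Euc N → ℝ) (g : L2Vec A) : Prop :=
  ∃ f : L2 A, f =ᵐ[volume.restrict A] w ∧ (f, g) ∈ closure (testGraph A)

/-- The Poincaré inequality holds on `A`. -/
def PoincareOn {N : ℕ} (A : Set (Euc N)) : Prop :=
  ∃ C : ℝ, ∀ φ : Euc N → ℝ, IsTest A φ →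
    ∫ x in A, φ x ^ 2 ≤ C * ∫ x in A, ‖gradient φ x‖ ^ 2

/-- The Poincaré inequality holds on every set that lies between two parallel coordinate hyperplanes,
in particular on every bounded set of `ℝ^N`, `N ≥ 1`. -/
theorem poincare_of_slab {N : ℕ} {A : Set (Euc N)} (i : Fin N) (R : ℝ)
    (hR : ∀ x ∈ A, |x i| ≤ R) : PoincareOn A := by
  refine ⟨4 * R ^ 2, fun φ ⟨hφ, hc, hs⟩ => ?_⟩
  have hd : Differentiable ℝ φ := hφ.differentiable (by simp)
  have hcf : Continuous (fderiv ℝ φ) := hφ.continuous_fderiv (by simp)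
  have hcg : Continuous (gradient φ) :=
    (InnerProductSpace.toDual ℝ (Euc N)).symm.continuous.comp hcf
  have hgs : HasCompactSupport (gradient φ) := by
    refine (hc.fderiv (𝕜 := ℝ)).mono ?_
    intro x hx hx'
    exact hx (by simp [gradient, hx'])
  have hz : ∀ x ∉ A, φ x = 0 := fun x hx => image_eq_zero_of_notMem_tsupport (fun h => hx (hs h))
  have hzg : ∀ x ∉ A, gradient φ x = 0 := fun x hx => by
    have : fderiv ℝ φ x = 0 := by
      by_contra h
      exact hx (hs (support_fderiv_subset ℝ h))
    simp [gradient, this]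
  rw [setIntegral_eq_integral_of_forall_compl_eq_zero (fun x hx => by simp [hz x hx]),
    setIntegral_eq_integral_of_forall_compl_eq_zero (fun x hx => by simp [hzg x hx])]
  set e : Euc N := EuclideanSpace.single i 1
  have hI1 : Integrable (fun x => φ x ^ 2) :=
    (hφ.continuous.pow 2).integrable_of_hasCompactSupport (by
      simpa [pow_two] using hc.mul_left (f' := φ))
  have hI2 : Integrable (fun x => ‖gradient φ x‖ ^ 2) :=
    (hcg.norm.pow 2).integrable_of_hasCompactSupport (by
      simpa [pow_two] using hgs.norm.mul_left (f' := fun x => ‖gradient φ x‖))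
  have hder : ∀ x, fderiv ℝ (fun x : Euc N => x i) x e = 1 := by
    intro x
    have : fderiv ℝ (fun x : Euc N => x i) x = EuclideanSpace.proj i :=
      (EuclideanSpace.proj i : Euc N →L[ℝ] ℝ).fderiv
    rw [this]; simp [e]
  have hdsq : ∀ x, fderiv ℝ (fun x => φ x ^ 2) x e = 2 * φ x * fderiv ℝ φ x e := by
    intro x
    rw [fderiv_fun_pow (n := 2) (hd x)]; simp
  have hci : Continuous (fun x : Euc N => x i) := by fun_prop
  have hcfe : Continuous (fun x => fderiv ℝ φ x e) := hcf.clm_apply continuous_const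
  have hI3 : Integrable (fun x : Euc N => x i * (2 * φ x * fderiv ℝ φ x e)) :=
    (hci.mul ((continuous_const.mul hφ.continuous).mul hcfe)).integrable_of_hasCompactSupport
      (HasCompactSupport.mul_left (HasCompactSupport.mul_right (hc.mul_left)))
  have key := integral_mul_fderiv_eq_neg_fderiv_mul_of_integrable (μ := (volume : Measure (Euc N)))
    (f := fun x : Euc N => x i) (g := fun x => φ x ^ 2) (v := e)
    (by simpa only [hder, one_mul] using hI1) (by simpa only [hdsq] using hI3)
    ((hci.mul (hφ.continuous.pow 2)).integrable_of_hasCompactSupport (by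
      simpa [pow_two] using HasCompactSupport.mul_left (f := fun x : Euc N => x i)
        (hc.mul_left (f' := φ) (f := φ)))) (fun x _ => by fun_prop) (fun x _ => by fun_prop)
  simp only [hder, hdsq, one_mul] at key
  have hpt : ∀ x, -(x i * (2 * φ x * fderiv ℝ φ x e)) ≤
      φ x ^ 2 / 2 + 2 * R ^ 2 * ‖gradient φ x‖ ^ 2 := by
    intro x
    by_cases hx : x ∈ A
    · have h1 : |fderiv ℝ φ x e| ≤ ‖gradient φ x‖ := by
        have := (fderiv ℝ φ x).le_opNorm e
        simpa [gradient, e] using this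
      have h2 := hR x hx
      have h3 : (x i * fderiv ℝ φ x e) ^ 2 ≤ R ^ 2 * ‖gradient φ x‖ ^ 2 := by
        rw [mul_pow, ← sq_abs (x i), ← sq_abs (fderiv ℝ φ x e)]
        gcongr
      nlinarith [sq_nonneg (φ x / 2 + x i * fderiv ℝ φ x e), sq_nonneg (φ x + 2 * (x i * fderiv ℝ φ x e))]
    · simp only [hz x hx]; simp; positivity
  have hle := integral_mono hI3.neg ((hI1.div_const 2).add (hI2.const_mul (2 * R ^ 2))) hpt
  have e1 : ∫ x, (-fun x : Euc N => x i * (2 * φ x * fderiv ℝ φ x e)) x = ∫ x, φ x ^ 2 := by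
    simp only [Pi.neg_apply, integral_neg]; linarith
  rw [e1] at hle
  simp only [Pi.add_apply] at hle
  rw [integral_add (hI1.div_const 2) (hI2.const_mul (2 * R ^ 2)), integral_div,
    integral_const_mul] at hle
  linarith

/-- `v` is a potential of the velocity of `u`: for almost every `t > 0`, `v(t) ∈ H^1_0(A)`,
`|v(t)| ≤ 1` a.e., `u_t = ∇v(t)` and `𝒟(u(t)) + ∫_A u(t) · ∇v(t) = 0`; `v` is measurable in
`(t, x)`. -/
structure IsPotential {N : ℕ} (A : Set (Euc N)) (u : ℝ → L2Vec A) (v : ℝ → Euc N → ℝ) :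
    Prop where
  measurable : AEStronglyMeasurable (Function.uncurry v)
    ((volume.restrict (Ioi (0 : ℝ))).prod (volume.restrict A))
  equation : ∀ᵐ t ∂(volume.restrict (Ioi (0 : ℝ))),
    (∀ᵐ x ∂(volume.restrict A), |v t x| ≤ 1) ∧
    ∃ g : L2Vec A, HasGradH10 A (v t) g ∧ HasDerivAt u g t ∧
      divMass A (u t) + ((∫ x in A, inner ℝ (u t x) (g x) : ℝ) : EReal) = 0

/-- `w(t, x) = ∫_0^t v(s, x) ds`. -/
def timeIntegral {N : ℕ} (v : ℝ → Euc N → ℝ) (t : ℝ) (x : Euc N) : ℝ :=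
  ∫ s in (0 : ℝ)..t, v s x

/-- `w`, with `∇w = g`, minimizes `½ ∫_A |u₀ + ∇w|²` among the `w ∈ H^1_0(A)` with
`|w| ≤ t` a.e. in `A`. -/
def SolvesObstacle {N : ℕ} (A : Set (Euc N)) (u₀ : L2Vec A) (t : ℝ) (w : Euc N → ℝ)
    (g : L2Vec A) : Prop :=
  HasGradH10 A w g ∧ (∀ᵐ x ∂(volume.restrict A), |w x| ≤ t) ∧
  ∀ (z : Euc N → ℝ) (h : L2Vec A), HasGradH10 A z h →
    (∀ᵐ x ∂(volume.restrict A), |z x| ≤ t) →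
    (1 / 2 : ℝ) * ∫ x in A, ‖u₀ x + g x‖ ^ 2 ≤ (1 / 2 : ℝ) * ∫ x in A, ‖u₀ x + h x‖ ^ 2

/-- The functional `𝒟(z) + (1 / 2t) ∫_A |z - u₀|²`. -/
def proxEnergy {N : ℕ} (A : Set (Euc N)) (u₀ : L2Vec A) (t : ℝ) (z : L2Vec A) : EReal :=
  divMass A z + (((1 / (2 * t)) * ∫ x in A, ‖z x - u₀ x‖ ^ 2 : ℝ) : EReal)

end DivFlow

end

open DivFlow

namespace DivFlow

open scoped Pointwise RealInnerProductSpace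

/-! Let K be `gradBall A`, the closed, convex, symmetric set of L²-limits of gradients ∇φ with |φ| ≤
1. Then 𝒟 is the support function of K, and ∂𝒟(u) is the face of K on which ⟪·, u⟫ is maximal. By
Moreau's decomposition the minimizer in (a) is u₀ - G(t), where G(t) is the projection of u₀ on tK
(`isMinOn_proxEnergy_iff`). For a general convex K this curve need not be the gradient flow; it is
as soon as G(t) - G(s) ∈ (t - s)K for s ≤ t.

This increment property is the heart of the proof, and it is a comparison principle for the obstacle
problem (`hasClampProperty_gradBall`, `exists_isProjCurve`). Given |φ| ≤ s and |ψ| ≤ s + h, let θ be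
the truncation of ψ - φ to [-h, h]. Then φ + θ and ψ - θ satisfy |φ + θ| ≤ s + h and |ψ - θ| ≤ s,
have the same sum as φ and ψ, and their gradients are no farther apart. By the parallelogram law the
total squared distance to u₀ does not increase. Hence if ∇φ and ∇ψ are nearly optimal, so is ∇φ +
∇θ, and G(s + h) - G(s) is a limit of such ∇θ. The truncation is smoothed to stay among test
functions.

The rest of (a) is Hilbert space geometry: difference quotients of G lie in faces of K, and their
norms are squeezed between values of a decreasing function (`IsProjCurve.lipschitz_and_hasDerivAt`).
Continuity at 0 comes from a dense set of vectors bounded on K (`IsProjCurve.tendsto_zero`),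
uniqueness from the monotonicity of ∂𝒟 (`IsGradientFlow.eq`).

For (b), the Poincaré inequality gives a bounded operator T with T(∇w) = w on H¹₀. Then v = T(u_t),
w = T(u - u₀), and tK is exactly the set of gradients of z ∈ H¹₀ with |z| ≤ t, so the obstacle
problem is, up to sign, the projection on tK. -/

theorem tendsto_of_sq_norm_le {H ι : Type*} [NormedAddCommGroup H] {l : Filter ι} {f : ι → H}
    {y : H} {r : ι → ℝ} (h : ∀ᶠ i in l, ‖f i - y‖ ^ 2 ≤ r i) (hr : Tendsto r l (𝓝 0)) :
    Tendsto f l (𝓝 y) := by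
  rw [tendsto_iff_norm_sub_tendsto_zero]
  have h1 : Tendsto (fun i => √(r i)) l (𝓝 0) := by
    simpa [Function.comp_def] using (Real.continuous_sqrt.tendsto 0).comp hr
  refine squeeze_zero' (Eventually.of_forall fun i => norm_nonneg _) ?_ h1
  filter_upwards [h] with i hi
  exact Real.le_sqrt_of_sq_le hi

/-! ### Projections on the multiples of a convex set in a Hilbert space -/

section Hilbert

variable {H : Type*} [NormedAddCommGroup H] [InnerProductSpace ℝ H]

/-- The elements of `K` at which the linear functional `⟪·, u⟫` attains its maximum over `K`. -/
def face (K : Set H) (u : H) : Set H := {p | p ∈ K ∧ ∀ k ∈ K, ⟪k, u⟫ ≤ ⟪p, u⟫}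

/-- `G t` is the projection of `x` on `t • K`, and the increments of `G` over intervals of length
`h` belong to `h • K`. -/
structure IsProjCurve (K : Set H) (x : H) (G : ℝ → H) : Prop where
  mem : ∀ t, 0 ≤ t → G t ∈ t • K
  var : ∀ t, 0 ≤ t → ∀ k ∈ t • K, ⟪x - G t, k - G t⟫ ≤ 0
  incr : ∀ s t, 0 ≤ s → s ≤ t → G t - G s ∈ (t - s) • K

theorem isClosed_smul_set {K : Set H} (hK : IsClosed K) (h0 : (0 : H) ∈ K) (t : ℝ) :
    IsClosed (t • K) := by
  rcases eq_or_ne t 0 with rfl | ht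
  · rw [zero_smul_set ⟨0, h0⟩]; exact isClosed_singleton
  · exact hK.smul₀ t

theorem exists_proj [CompleteSpace H] {K : Set H} (hK : IsClosed K) (hc : Convex ℝ K)
    (hne : K.Nonempty) (x : H) : ∃ g ∈ K, ∀ k ∈ K, ⟪x - g, k - g⟫ ≤ 0 := by
  obtain ⟨g, hg, h⟩ := exists_norm_eq_iInf_of_complete_convex hne hK.isComplete hc x
  exact ⟨g, hg, (norm_eq_iInf_iff_real_inner_le_zero hc hg).1 h⟩

theorem sq_norm_sub_le_of_proj {K : Set H} {x g k : H} (h : ∀ k ∈ K, ⟪x - g, k - g⟫ ≤ 0)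
    (hk : k ∈ K) : ‖x - g‖ ^ 2 + ‖k - g‖ ^ 2 ≤ ‖x - k‖ ^ 2 := by
  have e : x - k = (x - g) - (k - g) := by abel
  have h1 := norm_sub_sq_real (x - g) (k - g)
  rw [e, h1]
  linarith [h k hk]

/-- The comparison property that makes the projections on the sets `t • K` increase with
increments in the multiples of `K`. -/
def HasClampProperty (K : Set H) : Prop :=
  ∀ s h : ℝ, 0 < s → 0 < h → ∀ a ∈ s • K, ∀ b ∈ (s + h) • K, ∀ δ : ℝ, 0 < δ →
    ∃ a' b' m M : H, ‖a' - a‖ ≤ δ ∧ ‖b' - b‖ ≤ δ ∧ m ∈ (s + h) • K ∧ M ∈ s • K ∧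
      m - a' ∈ h • K ∧ m + M = a' + b' ∧ ‖m - M‖ ≤ ‖a' - b'‖

/-- Take `a`, `b` tending to `G s`, `G (s + h)`. The parallelogram law bounds the total squared
distance from `x` to `m` and `M` by that to `a` and `b`, which tends to the minimum. So `m` tends to
`G (s + h)`, and `m - a ∈ h • K` passes to the limit. -/
theorem exists_isProjCurve [CompleteSpace H] {K : Set H} (hK : IsClosed K) (hc : Convex ℝ K)
    (h0 : (0 : H) ∈ K) (hcl : HasClampProperty K) (x : H) : ∃ G, IsProjCurve K x G := by
  have hex : ∀ t : ℝ, ∃ g ∈ t • K, ∀ k ∈ t • K, ⟪x - g, k - g⟫ ≤ 0 := fun t =>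
    exists_proj (isClosed_smul_set hK h0 t) (hc.smul t) ⟨0, 0, h0, by simp⟩ x
  choose G hG hv using hex
  refine ⟨G, fun t _ => hG t, fun t _ => hv t, fun s t hs hst => ?_⟩
  rcases hst.eq_or_lt with rfl | hst
  · exact ⟨0, h0, by simp⟩
  rcases hs.eq_or_lt with rfl | hs
  · have : G 0 = 0 := by
      obtain ⟨k, -, hk⟩ := hG 0
      simpa using hk.symm
    simpa [this] using hG t
  obtain ⟨h, rfl⟩ : ∃ h, t = s + h := ⟨t - s, by ring⟩
  have hh : 0 < h := by linarith
  have hδ : ∀ n : ℕ, 0 < 1 / ((n : ℝ) + 1) := fun n => by positivity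
  choose a b m M ha hb hm hM hma hsum hsq using
    fun n : ℕ => hcl s h hs hh (G s) (hG s) (G (s + h)) (hG _) _ (hδ n)
  have hlim := tendsto_one_div_add_atTop_nhds_zero_nat (𝕜 := ℝ)
  have hat : Tendsto a atTop (𝓝 (G s)) := tendsto_iff_norm_sub_tendsto_zero.2
    (squeeze_zero (fun n => norm_nonneg _) ha hlim)
  have hbt : Tendsto b atTop (𝓝 (G (s + h))) := tendsto_iff_norm_sub_tendsto_zero.2
    (squeeze_zero (fun n => norm_nonneg _) hb hlim)
  have hmt : Tendsto m atTop (𝓝 (G (s + h))) := by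
    refine tendsto_of_sq_norm_le (r := fun n => ‖x - a n‖ ^ 2 + ‖x - b n‖ ^ 2 - ‖x - G s‖ ^ 2
      - ‖x - G (s + h)‖ ^ 2) (Eventually.of_forall fun n => ?_) ?_
    · have h1 := sq_norm_sub_le_of_proj (hv (s + h)) (hm n)
      have h2 := sq_norm_sub_le_of_proj (hv s) (hM n)
      have h3 : ‖x - m n‖ ^ 2 + ‖x - M n‖ ^ 2 ≤ ‖x - a n‖ ^ 2 + ‖x - b n‖ ^ 2 := by
        have h4 := parallelogram_law_with_norm ℝ (x - m n) (x - M n)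
        have h5 := parallelogram_law_with_norm ℝ (x - a n) (x - b n)
        have e1 : x - m n + (x - M n) = x - a n + (x - b n) := by
          rw [sub_add_sub_comm, hsum, ← sub_add_sub_comm]
        have e2 : ‖x - m n - (x - M n)‖ ≤ ‖x - a n - (x - b n)‖ := by
          rw [sub_sub_sub_cancel_left, sub_sub_sub_cancel_left, norm_sub_rev,
            norm_sub_rev (b n)]
          exact hsq n
        rw [e1] at h4
        have := mul_self_le_mul_self (norm_nonneg _) e2
        linarith
      linarith [sq_nonneg ‖M n - G s‖]
    · have := ((((tendsto_const_nhds (x := x)).sub hat).norm.pow 2).add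
        (((tendsto_const_nhds (x := x)).sub hbt).norm.pow 2)).sub_const (‖x - G s‖ ^ 2)
      have := this.sub_const (‖x - G (s + h)‖ ^ 2)
      convert! this using 2
      ring
  rw [add_sub_cancel_left]
  exact (isClosed_smul_set hK h0 h).mem_of_tendsto (hmt.sub hat) (Eventually.of_forall hma)

namespace IsProjCurve

variable {K : Set H} {x : H} {G : ℝ → H}

theorem zero (hG : IsProjCurve K x G) : G 0 = 0 := by
  obtain ⟨k, -, hk⟩ := hG.mem 0 le_rfl
  simpa using hk.symm

/-- Replacing the last increment by `(t - s) • k` keeps the point in `t • K` by convexity, so the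
variational inequality at `t` compares `p` with any `k`. -/
theorem mem_face_of_increment (hG : IsProjCurve K x G) (hc : Convex ℝ K) {s t : ℝ} (hs : 0 ≤ s)
    (hst : s < t) {p : H} (hp : p ∈ K) (h : (t - s) • p = G t - G s) :
    p ∈ face K (x - G t) := by
  refine ⟨hp, fun k hk => ?_⟩
  obtain ⟨q, hq, hqs⟩ := hG.mem s hs
  have ht : 0 < t := hs.trans_lt hst
  have hmem : s • q + (t - s) • k ∈ t • K := by
    refine ⟨(s / t) • q + ((t - s) / t) • k, hc hq hk (by positivity)
      (div_nonneg (by linarith) ht.le) (by field_simp; ring), ?_⟩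
    simp only [smul_add, smul_smul]
    rw [mul_div_cancel₀ _ ht.ne', mul_div_cancel₀ _ ht.ne']
  have h1 := hG.var t ht.le _ hmem
  have e : s • q + (t - s) • k - G t = (t - s) • (k - p) := by
    rw [smul_sub, h, ← hqs]; abel
  rw [e, inner_smul_right, real_inner_comm, inner_sub_left] at h1
  have : 0 < t - s := by linarith
  nlinarith

/-- Monotonicity of the face map: add the maximality of `q` at `x - G s` to that of `p` at `x - G
t`, the two points differing by `(t - s) • p`. -/
theorem sq_norm_increment_le (hG : IsProjCurve K x G) (hc : Convex ℝ K) {s t : ℝ} (hs : 0 ≤ s)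
    (hst : s < t) {p q : H} (hp : p ∈ K) (h : (t - s) • p = G t - G s)
    (hq : q ∈ face K (x - G s)) : ‖p‖ ^ 2 ≤ ⟪q, p⟫ := by
  have h1 := hq.2 p hp
  have h2 := (hG.mem_face_of_increment hc hs hst hp h).2 q hq.1
  have e : x - G t = (x - G s) - (t - s) • p := by rw [h]; abel
  rw [e, inner_sub_right q, inner_sub_right p, real_inner_smul_right, real_inner_smul_right,
    real_inner_self_eq_norm_sq] at h2
  have : 0 < t - s := by linarith
  nlinarith

theorem exists_increment (hG : IsProjCurve K x G) {s t : ℝ} (hs : 0 ≤ s) (hst : s ≤ t) :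
    ∃ p ∈ K, (t - s) • p = G t - G s := hG.incr s t hs hst

theorem exists_smul_eq (hG : IsProjCurve K x G) (hc : Convex ℝ K) {t : ℝ} (ht : 0 < t) :
    ∃ p ∈ face K (x - G t), t • p = G t := by
  obtain ⟨p, hp, h⟩ := hG.exists_increment le_rfl ht.le
  exact ⟨p, hG.mem_face_of_increment hc le_rfl ht hp h, by simpa [hG.zero] using h⟩

end IsProjCurve

theorem isClosed_face {K : Set H} (hK : IsClosed K) (u : H) : IsClosed (face K u) := by
  have : face K u = K ∩ ⋂ k ∈ K, {p | ⟪k, u⟫ ≤ ⟪p, u⟫} := by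
    ext p; simp [face]
  rw [this]
  exact hK.inter (isClosed_biInter fun k _ =>
    isClosed_le continuous_const (continuous_id.inner continuous_const))

theorem convex_face {K : Set H} (hc : Convex ℝ K) (u : H) : Convex ℝ (face K u) := by
  intro p hp q hq a b ha hb hab
  refine ⟨hc hp.1 hq.1 ha hb hab, fun k hk => ?_⟩
  rw [inner_add_left, real_inner_smul_left, real_inner_smul_left]
  have h1 := mul_le_mul_of_nonneg_left (hp.2 k hk) ha
  have h2 := mul_le_mul_of_nonneg_left (hq.2 k hk) hb
  have : ⟪k, u⟫ = a * ⟪k, u⟫ + b * ⟪k, u⟫ := by rw [← add_mul, hab, one_mul]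
  linarith

theorem norm_le_of_sq_le_inner {p q : H} (h : ‖p‖ ^ 2 ≤ ⟪q, p⟫) : ‖p‖ ≤ ‖q‖ := by
  have h1 := real_inner_le_norm q p
  rcases (norm_nonneg p).eq_or_lt with h0 | h0
  · rw [← h0]; exact norm_nonneg q
  · nlinarith

/-- The projection curve is Lipschitz away from `0` and almost everywhere differentiable, and its
derivatives are in the faces of `K`. -/
theorem IsProjCurve.lipschitz_and_hasDerivAt [CompleteSpace H] {K : Set H} {x : H} {G : ℝ → H}
    (hG : IsProjCurve K x G) (hK : IsClosed K) (hc : Convex ℝ K) :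
    (∀ a, 0 < a → ∃ C : NNReal, LipschitzOnWith C G (Ici a)) ∧
    ∀ᵐ t ∂(volume.restrict (Ioi (0 : ℝ))), ∃ p ∈ face K (x - G t), HasDerivAt G p t := by
  -- `P t` will be the element of minimal norm of the face, the expected right derivative of `G`;
  -- its value for `t ≤ 0` is irrelevant.
  have hex : ∀ t : ℝ, ∃ p : H, 0 < t → p ∈ face K (x - G t) ∧
      ∀ q ∈ face K (x - G t), ‖p‖ ^ 2 ≤ ⟪q, p⟫ := by
    intro t
    by_cases ht : 0 < t
    · obtain ⟨q, hq, -⟩ := hG.exists_smul_eq hc ht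
      obtain ⟨p, hp, h⟩ := exists_proj (isClosed_face hK _) (convex_face hc _) ⟨q, hq⟩ (0 : H)
      refine ⟨p, fun _ => ⟨hp, fun q hq => ?_⟩⟩
      have := h q hq
      rw [zero_sub, inner_neg_left, inner_sub_right, real_inner_self_eq_norm_sq,
        real_inner_comm] at this
      linarith
    · exact ⟨0, fun h => absurd h ht⟩
  choose P hP using hex
  have hstep : ∀ s t, 0 < s → s < t → ∀ p ∈ K, (t - s) • p = G t - G s →
      ‖P t‖ ≤ ‖p‖ ∧ ‖p‖ ≤ ‖P s‖ := by
    intro s t hs hst p hp h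
    refine ⟨norm_le_of_sq_le_inner ((hP t (hs.trans hst)).2 p
      (hG.mem_face_of_increment hc hs.le hst hp h)), norm_le_of_sq_le_inner
      (hG.sq_norm_increment_le hc hs.le hst hp h (hP s hs).1)⟩
  have hanti : AntitoneOn (fun t => ‖P t‖) (Ioi 0) := by
    intro s hs t _ hst
    rcases hst.eq_or_lt with rfl | hst
    · exact le_rfl
    obtain ⟨p, hp, h⟩ := hG.exists_increment (le_of_lt hs) hst.le
    exact (hstep s t hs hst p hp h).1.trans (hstep s t hs hst p hp h).2
  constructor
  · intro a ha
    refine ⟨‖P a‖₊, LipschitzOnWith.of_dist_le_mul fun t ht s hs => ?_⟩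
    have key : ∀ s t, a ≤ s → s ≤ t → dist (G t) (G s) ≤ ‖P a‖ * (t - s) := by
      intro s t has hst
      rcases hst.eq_or_lt with rfl | hst
      · simp
      obtain ⟨p, hp, h⟩ := hG.exists_increment (ha.le.trans has) hst.le
      have hs0 : 0 < s := ha.trans_le has
      rw [dist_eq_norm, ← h, norm_smul, Real.norm_of_nonneg (by linarith), mul_comm]
      gcongr
      exact (hstep s t hs0 hst p hp h).2.trans (hanti ha hs0 has)
    rw [coe_nnnorm, Real.dist_eq]
    rcases le_total s t with h | h
    · rw [abs_of_nonneg (by linarith)]; exact key s t hs h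
    · rw [abs_of_nonpos (by linarith), dist_comm, neg_sub]; exact key t s ht h
  -- A monotone function has countably many discontinuities; at every continuity point of `‖P‖` the
  -- slopes converge to `P t`.
  · have hcount := (hanti.countable_not_continuousWithinAt).ae_notMem volume
    rw [ae_restrict_iff' measurableSet_Ioi]
    filter_upwards [hcount] with t htc ht
    have hcont : ContinuousWithinAt (fun t => ‖P t‖) (Ioi 0) t := by
      by_contra hcon
      exact htc ⟨ht, hcon⟩
    have hcont : ContinuousAt (fun t => ‖P t‖) t := hcont.continuousAt (Ioi_mem_nhds ht)
    refine ⟨P t, (hP t ht).1, hasDerivAt_iff_tendsto_slope.2 ?_⟩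
    -- Expand `‖p - P t‖ ^ 2` for the slope `p`. On the left `‖P t‖ ^ 2 ≤ ⟪p, P t⟫`, since `p` is in
    -- the face at `t`; on the right `‖p‖ ^ 2 ≤ ⟪P t, p⟫`. In both cases a difference of squared
    -- norms remains, and the sandwich `hstep` bounds it.
    refine tendsto_of_sq_norm_le (r := fun y => |‖P y‖ ^ 2 - ‖P t‖ ^ 2|) ?_ ?_
    · filter_upwards [self_mem_nhdsWithin, nhdsWithin_le_nhds (Ioi_mem_nhds ht)] with y hy hy0
      rw [mem_Ioi] at ht hy0
      rcases lt_or_gt_of_ne hy with hyt | hyt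
      · obtain ⟨p, hp, h⟩ := hG.exists_increment hy0.le hyt.le
        have e : slope G t y = p := by
          rw [slope_comm, slope_def_module, ← h, smul_smul, inv_mul_cancel₀ (by linarith), one_smul]
        have h1 := (hP t ht).2 p (hG.mem_face_of_increment hc hy0.le hyt hp h)
        have h2 := (hstep y t hy0 hyt p hp h).2
        rw [e, norm_sub_sq_real]
        refine le_trans ?_ (le_abs_self _)
        have : ‖p‖ ^ 2 ≤ ‖P y‖ ^ 2 := by gcongr
        linarith
      · obtain ⟨p, hp, h⟩ := hG.exists_increment (le_of_lt ht) (le_of_lt hyt)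
        have e : slope G t y = p := by
          rw [slope_def_module, ← h, smul_smul, inv_mul_cancel₀ (sub_ne_zero.2 hy), one_smul]
        have h1 := hG.sq_norm_increment_le hc ht.le hyt hp h (hP t ht).1
        have h2 := (hstep t y ht hyt p hp h).1
        rw [e, norm_sub_sq_real, abs_sub_comm]
        refine le_trans ?_ (le_abs_self _)
        have : ‖P y‖ ^ 2 ≤ ‖p‖ ^ 2 := by gcongr
        rw [real_inner_comm] at h1
        linarith
    · have h1 : Tendsto (fun y => |‖P y‖ ^ 2 - ‖P t‖ ^ 2|) (𝓝 t) (𝓝 |‖P t‖ ^ 2 - ‖P t‖ ^ 2|) :=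
        ((hcont.tendsto.pow 2).sub_const _).abs
      rw [sub_self, abs_zero] at h1
      exact h1.mono_left nhdsWithin_le_nhds

/-- The vectors that are bounded as linear functionals on `K`. -/
def boundedOn (K : Set H) : Submodule ℝ H where
  carrier := {y | ∃ M : ℝ, ∀ k ∈ K, |⟪k, y⟫| ≤ M}
  zero_mem' := ⟨0, fun k _ => by simp⟩
  add_mem' := by
    rintro y z ⟨M, hM⟩ ⟨M', hM'⟩
    refine ⟨M + M', fun k hk => ?_⟩
    rw [inner_add_right]
    exact (abs_add_le _ _).trans (add_le_add (hM k hk) (hM' k hk))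
  smul_mem' := by
    rintro c y ⟨M, hM⟩
    refine ⟨|c| * M, fun k hk => ?_⟩
    rw [real_inner_smul_right, abs_mul]
    exact mul_le_mul_of_nonneg_left (hM k hk) (abs_nonneg c)

theorem eq_zero_of_forall_mem_smul {K : Set H} (hd : Dense (boundedOn K : Set H)) {h : H}
    (hh : ∀ δ : ℝ, 0 < δ → h ∈ δ • K) : h = 0 := by
  refine hd.eq_zero_of_inner_left ℝ fun y hy => ?_
  obtain ⟨M, hM⟩ := hy
  have hlim : Tendsto (fun δ : ℝ => δ * M) (𝓝[>] 0) (𝓝 0) := by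
    have : Tendsto (fun δ : ℝ => δ * M) (𝓝 0) (𝓝 (0 * M)) := tendsto_id.mul_const M
    rw [zero_mul] at this
    exact this.mono_left nhdsWithin_le_nhds
  have : |⟪h, y⟫| ≤ 0 := by
    refine ge_of_tendsto hlim ?_
    filter_upwards [self_mem_nhdsWithin] with δ hδ
    obtain ⟨k, hk, hkh⟩ := hh δ hδ
    simp only at hkh
    rw [← hkh, real_inner_smul_left, abs_mul, abs_of_pos hδ]
    exact mul_le_mul_of_nonneg_left (hM k hk) (le_of_lt hδ)
  exact abs_nonpos_iff.1 this

/-- Comparison with `0` gives `‖G t‖ ^ 2 ≤ ⟪x, G t⟫`. Splitting `x` into a small part and a vector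
`y` bounded by `M` on `K` bounds the right side by `ε / 2 * ‖G t‖ + t * M`. -/
theorem IsProjCurve.tendsto_zero {K : Set H} {x : H} {G : ℝ → H} (hG : IsProjCurve K x G)
    (h0 : (0 : H) ∈ K) (hd : Dense (boundedOn K : Set H)) :
    Tendsto G (𝓝[≥] 0) (𝓝 0) := by
  rw [Metric.tendsto_nhdsWithin_nhds]
  intro ε hε
  obtain ⟨y, ⟨M, hM⟩, hy⟩ := hd.exists_dist_lt x (half_pos hε)
  have hM0 : 0 ≤ M := by simpa using hM 0 h0
  -- This radius gives `t * M < ε ^ 2 / 4`, whereas `ε ≤ ‖G t‖` would force `t * M ≥ ε ^ 2 / 2`.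
  refine ⟨ε ^ 2 / (4 * (M + 1)), by positivity, fun t ht htd => ?_⟩
  rw [dist_zero_right] at *
  rw [mem_Ici] at ht
  rw [Real.norm_of_nonneg ht, lt_div_iff₀ (by positivity)] at htd
  have h1 := hG.var t ht 0 ⟨0, h0, by simp⟩
  rw [zero_sub, inner_neg_right, inner_sub_left, real_inner_self_eq_norm_sq] at h1
  have h2 : ⟪y, G t⟫ ≤ t * M := by
    obtain ⟨k, hk, hkt⟩ := hG.mem t ht
    simp only at hkt
    rw [← hkt, inner_smul_right, real_inner_comm]
    exact mul_le_mul_of_nonneg_left ((le_abs_self _).trans (hM k hk)) ht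
  have h3 : ⟪x - y, G t⟫ ≤ ε / 2 * ‖G t‖ := by
    refine (real_inner_le_norm _ _).trans ?_
    gcongr
    rw [← dist_eq_norm]; exact hy.le
  rw [inner_sub_left] at h3
  by_contra hcon
  push Not at hcon
  nlinarith [norm_nonneg (G t)]

theorem absolutelyContinuousOnInterval_norm {F : Type*} [NormedAddCommGroup F] {y : ℝ → F}
    {a b : ℝ} (hy : AbsolutelyContinuousOnInterval y a b) :
    AbsolutelyContinuousOnInterval (fun t => ‖y t‖) a b := by
  refine squeeze_zero (fun _ => Finset.sum_nonneg fun _ _ => dist_nonneg) (fun E => ?_) hy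
  refine Finset.sum_le_sum fun i _ => ?_
  rw [dist_eq_norm (y _)]
  exact dist_norm_norm_le _ _

/-- The function `‖y‖ ^ 2` is absolutely continuous with derivative `2 * ⟪y, y'⟫ ≤ 0`, but only away
from `0`; continuity lets the left endpoint tend to `0`. -/
theorem eq_zero_of_dissipative {y : ℝ → H} (hcont : ContinuousOn y (Ici 0))
    (hac : ∀ a b : ℝ, 0 < a → a ≤ b → AbsolutelyContinuousOnInterval y a b)
    (hd : ∀ᵐ t ∂(volume.restrict (Ioi (0 : ℝ))), ∃ d, HasDerivAt y d t ∧ ⟪y t, d⟫ ≤ 0)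
    (h0 : y 0 = 0) {t : ℝ} (ht : 0 ≤ t) : y t = 0 := by
  rcases ht.eq_or_lt with rfl | ht
  · exact h0
  have hle : ∀ a, 0 < a → a ≤ t → ‖y t‖ ^ 2 ≤ ‖y a‖ ^ 2 := by
    intro a ha hat
    have hn := absolutelyContinuousOnInterval_norm (hac a t ha hat)
    have hF := (hn.mul hn).integral_deriv_eq_sub
    have hnonpos : ∫ s in a..t, deriv ((fun t => ‖y t‖) * fun t => ‖y t‖) s ≤ 0 := by
      rw [intervalIntegral.integral_of_le hat]
      refine integral_nonpos_of_ae ?_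
      have hsub : Ioc a t ⊆ Ioi 0 := fun s hs => ha.trans hs.1
      filter_upwards [ae_restrict_of_ae_restrict_of_subset hsub hd] with s ⟨d, hd, hle⟩
      have e : ((fun t => ‖y t‖) * fun t => ‖y t‖) = fun t => ⟪y t, y t⟫ := by
        ext t; rw [real_inner_self_eq_norm_mul_norm]; rfl
      rw [e, (hd.inner ℝ hd).deriv, real_inner_comm (y s) d]
      simp only [Pi.zero_apply]
      linarith
    simp only [Pi.mul_apply] at hF
    nlinarith
  have hlim : Tendsto (fun a => ‖y a‖ ^ 2) (𝓝[>] 0) (𝓝 (‖y 0‖ ^ 2)) :=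
    ((hcont 0 self_mem_Ici).mono_left (nhdsWithin_mono _ Ioi_subset_Ici_self)).norm.pow 2
  have : ‖y t‖ ^ 2 ≤ ‖y 0‖ ^ 2 := by
    refine ge_of_tendsto hlim ?_
    filter_upwards [Ioc_mem_nhdsGT ht] with a ha
    exact hle a ha.1 ha.2
  rw [h0] at this
  have h1 : ‖y t‖ ^ 2 = 0 := le_antisymm (by simpa using this) (sq_nonneg _)
  simpa using h1

end Hilbert

/-! ### A smooth truncation on the real line -/

section SoftClamp

/-- A smooth approximation of the truncation of `d` to `[-μ, μ]`. -/
noncomputable def softClamp (μ ε d : ℝ) : ℝ :=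
  (√((d + μ) ^ 2 + ε ^ 2) - √((d - μ) ^ 2 + ε ^ 2)) / 2

/-- The derivative of `softClamp μ ε`. -/
noncomputable def softClampDeriv (μ ε d : ℝ) : ℝ :=
  ((d + μ) / √((d + μ) ^ 2 + ε ^ 2) - (d - μ) / √((d - μ) ^ 2 + ε ^ 2)) / 2

variable {μ ε : ℝ}

theorem hasDerivAt_sqrt_sq_add (hε : 0 < ε) (c d : ℝ) :
    HasDerivAt (fun d => √((d + c) ^ 2 + ε ^ 2)) ((d + c) / √((d + c) ^ 2 + ε ^ 2)) d := by
  have h := ((((hasDerivAt_id d).add_const c).pow 2).add_const (ε ^ 2)).sqrt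
    (by simp only [id, Pi.pow_apply]; positivity)
  convert! h using 1
  simp
  field_simp

theorem hasDerivAt_softClamp (hε : 0 < ε) (d : ℝ) :
    HasDerivAt (softClamp μ ε) (softClampDeriv μ ε d) d :=
  ((hasDerivAt_sqrt_sq_add hε μ d).sub (hasDerivAt_sqrt_sq_add hε (-μ) d)).div_const 2

theorem contDiff_softClamp (hε : 0 < ε) : ContDiff ℝ ∞ (softClamp μ ε) := by
  unfold softClamp
  refine ContDiff.div_const (ContDiff.sub ?_ ?_) 2
  · exact ContDiff.sqrt (by fun_prop) fun x => by positivity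
  · exact ContDiff.sqrt (by fun_prop) fun x => by positivity

theorem softClamp_zero : softClamp μ ε 0 = 0 := by simp [softClamp]

theorem abs_le_sqrt_sq_add (x ε : ℝ) : |x| ≤ √(x ^ 2 + ε ^ 2) :=
  Real.abs_le_sqrt (by nlinarith [sq_nonneg ε])

theorem sqrt_sq_add_le (hε : 0 < ε) (x : ℝ) : √(x ^ 2 + ε ^ 2) ≤ |x| + ε := by
  rw [Real.sqrt_le_left (by positivity)]
  nlinarith [sq_abs x, mul_nonneg (abs_nonneg x) hε.le]

theorem monotone_div_sqrt (hε : 0 < ε) : Monotone fun x : ℝ => x / √(x ^ 2 + ε ^ 2) := by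
  intro x y hxy
  have hx : 0 < √(x ^ 2 + ε ^ 2) := by positivity
  have hy : 0 < √(y ^ 2 + ε ^ 2) := by positivity
  simp only
  rw [div_le_div_iff₀ hx hy]
  rcases le_total 0 x with h | h
  · have h1 := Real.sqrt_le_sqrt (show x ^ 2 * (y ^ 2 + ε ^ 2) ≤ y ^ 2 * (x ^ 2 + ε ^ 2) by
      nlinarith [mul_le_mul h hxy h h, sq_nonneg ε, mul_self_le_mul_self h hxy])
    rwa [Real.sqrt_mul (sq_nonneg _), Real.sqrt_mul (sq_nonneg _), Real.sqrt_sq h,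
      Real.sqrt_sq (h.trans hxy)] at h1
  · rcases le_total 0 y with h' | h'
    · exact (mul_nonpos_of_nonpos_of_nonneg h hy.le).trans (mul_nonneg h' hx.le)
    · have h1 := Real.sqrt_le_sqrt (show y ^ 2 * (x ^ 2 + ε ^ 2) ≤ x ^ 2 * (y ^ 2 + ε ^ 2) by
        nlinarith [sq_nonneg ε, mul_self_le_mul_self (neg_nonneg.2 h') (neg_le_neg hxy)])
      rw [Real.sqrt_mul (sq_nonneg _), Real.sqrt_mul (sq_nonneg _), ← neg_sq x, ← neg_sq y,
        Real.sqrt_sq (neg_nonneg.2 h), Real.sqrt_sq (neg_nonneg.2 h'), neg_sq, neg_sq] at h1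
      linarith

theorem abs_div_sqrt_le (x ε : ℝ) : |x / √(x ^ 2 + ε ^ 2)| ≤ 1 := by
  rw [abs_div, abs_of_nonneg (Real.sqrt_nonneg _)]
  exact div_le_one_of_le₀ (abs_le_sqrt_sq_add x ε) (Real.sqrt_nonneg _)

theorem softClampDeriv_mem (hε : 0 < ε) (hμ : 0 ≤ μ) (d : ℝ) :
    softClampDeriv μ ε d ∈ Icc (0 : ℝ) 1 := by
  have h1 := monotone_div_sqrt hε (show d - μ ≤ d + μ by linarith)
  have h2 := abs_le.1 (abs_div_sqrt_le (d + μ) ε)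
  have h3 := abs_le.1 (abs_div_sqrt_le (d - μ) ε)
  simp only at h1
  constructor <;> unfold softClampDeriv <;> linarith [h2.1, h2.2, h3.1, h3.2]

theorem abs_softClamp_le (hε : 0 < ε) (hμ : 0 ≤ μ) (d : ℝ) : |softClamp μ ε d| ≤ μ := by
  have key : ∀ x y : ℝ, √(x ^ 2 + ε ^ 2) ≤ √(y ^ 2 + ε ^ 2) + |x - y| := by
    intro x y
    rw [Real.sqrt_le_left (by positivity)]
    have h := Real.sq_sqrt (show 0 ≤ y ^ 2 + ε ^ 2 by positivity)
    have h1 := mul_le_mul_of_nonneg_right (abs_le_sqrt_sq_add y ε) (abs_nonneg (x - y))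
    rw [← abs_mul] at h1
    nlinarith [sq_abs (x - y), le_abs_self (y * (x - y))]
  have h1 := key (d + μ) (d - μ)
  have h2 := key (d - μ) (d + μ)
  rw [show d + μ - (d - μ) = 2 * μ by ring, abs_of_nonneg (by positivity)] at h1
  rw [show d - μ - (d + μ) = -(2 * μ) by ring, abs_neg, abs_of_nonneg (by positivity)] at h2
  rw [abs_le]
  constructor <;> unfold softClamp <;> linarith

/-- With the exact truncation, the bound would be `s - ε`; smoothing costs at most `ε / 2`, which
the margin absorbs. -/
theorem abs_sub_softClamp_le (hε : 0 < ε) {s a b : ℝ} (hμ : 0 ≤ μ) (ha : |a| ≤ s - ε)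
    (hb : |b| ≤ s + μ - ε) : |b - softClamp μ ε (b - a)| ≤ s := by
  have h1 := sqrt_sq_add_le hε (b - a + μ)
  have h2 := sqrt_sq_add_le hε (b - a - μ)
  have h3 := abs_le_sqrt_sq_add (b - a + μ) ε
  have h4 := abs_le_sqrt_sq_add (b - a - μ) ε
  unfold softClamp
  rw [abs_le] at ha hb h3 h4 ⊢
  constructor <;> rcases abs_cases (b - a + μ) with ⟨e1, _⟩ | ⟨e1, _⟩ <;>
    rcases abs_cases (b - a - μ) with ⟨e2, _⟩ | ⟨e2, _⟩ <;> linarith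

/-- Since `t < μ`, the limit `z` stays away from the corners `±μ`, where one of the two quotients
would have no determined limit. -/
theorem tendsto_softClampDeriv {t : ℝ} (ht : t < μ) {z : ℝ} (hz : |z| ≤ t) {f r : ℕ → ℝ}
    (hf : Tendsto f atTop (𝓝 z)) (hr : Tendsto r atTop (𝓝 0)) :
    Tendsto (fun n => softClampDeriv μ (r n) (f n)) atTop (𝓝 1) := by
  have hz := abs_le.1 hz
  have h1 : 0 < z + μ := by linarith [hz.1]
  have h2 : z - μ < 0 := by linarith [hz.2]
  have key : ∀ c : ℝ, z + c ≠ 0 → Tendsto (fun n => (f n + c) / √((f n + c) ^ 2 + (r n) ^ 2))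
      atTop (𝓝 ((z + c) / |z + c|)) := by
    intro c hc
    have := (hf.add_const c).div (Real.continuous_sqrt.continuousAt.tendsto.comp
      (((hf.add_const c).pow 2).add (hr.pow 2))) (by
        rw [zero_pow two_ne_zero, add_zero, Real.sqrt_sq_eq_abs]; exact abs_ne_zero.2 hc)
    rw [zero_pow two_ne_zero, add_zero, Real.sqrt_sq_eq_abs] at this
    exact this
  have h := ((key μ h1.ne').sub (key (-μ) h2.ne)).div_const 2
  have e : ((z + μ) / |z + μ| - (z + -μ) / |z + -μ|) / 2 = 1 := by
    rw [← sub_eq_add_neg, abs_of_pos h1, abs_of_neg h2, div_self h1.ne', div_neg, div_self h2.ne]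
    norm_num
  rw [e] at h
  exact h

end SoftClamp

/-! ### Gradients of bounded test functions and the comparison principle -/

section Test

variable {N : ℕ} {A : Set (Euc N)} {φ ψ f : Euc N → ℝ}

theorem IsTest.of_support (hφ : IsTest A φ) (hψ : IsTest A ψ) (hf : ContDiff ℝ ∞ f)
    (h : ∀ x, φ x = 0 → ψ x = 0 → f x = 0) : IsTest A f := by
  have hsub : Function.support f ⊆ tsupport φ ∪ tsupport ψ := by
    intro x hx
    by_contra hcon
    rw [mem_union, not_or] at hcon
    exact hx (h x (image_eq_zero_of_notMem_tsupport hcon.1)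
      (image_eq_zero_of_notMem_tsupport hcon.2))
  have hcl : tsupport f ⊆ tsupport φ ∪ tsupport ψ :=
    closure_minimal hsub ((isClosed_tsupport φ).union (isClosed_tsupport ψ))
  exact ⟨hf, (IsCompact.union hφ.2.1 hψ.2.1).of_isClosed_subset (isClosed_tsupport f) hcl,
    hcl.trans (union_subset hφ.2.2 hψ.2.2)⟩

theorem IsTest.zero : IsTest A fun _ => (0 : ℝ) := by
  refine ⟨contDiff_const, ?_, ?_⟩
  · exact HasCompactSupport.zero
  · have : tsupport (fun _ : Euc N => (0 : ℝ)) = ∅ := tsupport_eq_empty_iff.2 rfl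
    simp [this]

theorem IsTest.linComb (hφ : IsTest A φ) (hψ : IsTest A ψ) (a b : ℝ) :
    IsTest A fun x => a * φ x + b * ψ x :=
  hφ.of_support hψ ((contDiff_const.mul hφ.1).add (contDiff_const.mul hψ.1))
    fun x h1 h2 => by simp [h1, h2]

theorem IsTest.hasFDerivAt (hφ : IsTest A φ) (x : Euc N) : HasFDerivAt φ (fderiv ℝ φ x) x :=
  (hφ.1.differentiable (by simp) x).hasFDerivAt

theorem IsTest.continuous_gradient (hφ : IsTest A φ) : Continuous (gradient φ) :=
  (InnerProductSpace.toDual ℝ (Euc N)).symm.continuous.comp (hφ.1.continuous_fderiv (by simp))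

theorem IsTest.hasCompactSupport_gradient (hφ : IsTest A φ) : HasCompactSupport (gradient φ) :=
  (hφ.2.1.fderiv (𝕜 := ℝ)).mono fun x hx hx' => hx (by simp [gradient, hx'])

theorem IsTest.memLp (hφ : IsTest A φ) : MemLp φ 2 (volume.restrict A) :=
  (hφ.1.continuous.memLp_of_hasCompactSupport hφ.2.1).restrict A

theorem IsTest.memLp_gradient (hφ : IsTest A φ) : MemLp (gradient φ) 2 (volume.restrict A) :=
  (hφ.continuous_gradient.memLp_of_hasCompactSupport hφ.hasCompactSupport_gradient).restrict A

theorem gradient_eq_of_hasFDerivAt {x : Euc N} {a b : ℝ}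
    (h : HasFDerivAt f (a • fderiv ℝ φ x + b • fderiv ℝ ψ x) x) :
    gradient f x = a • gradient φ x + b • gradient ψ x := by
  simp [gradient, h.fderiv]

theorem IsTest.gradient_linComb (hφ : IsTest A φ) (hψ : IsTest A ψ) (a b : ℝ) (x : Euc N) :
    gradient (fun x => a * φ x + b * ψ x) x = a • gradient φ x + b • gradient ψ x :=
  gradient_eq_of_hasFDerivAt (((hφ.hasFDerivAt x).const_mul a).add ((hψ.hasFDerivAt x).const_mul b))

/-- The gradient of a test function as an element of `L²`. -/
noncomputable def gradLp (hφ : IsTest A φ) : L2Vec A := hφ.memLp_gradient.toLp (gradient φ)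

theorem coeFn_gradLp (hφ : IsTest A φ) : gradLp hφ =ᵐ[volume.restrict A] gradient φ :=
  hφ.memLp_gradient.coeFn_toLp

theorem gradLp_linComb (hφ : IsTest A φ) (hψ : IsTest A ψ) (a b : ℝ) :
    gradLp (hφ.linComb hψ a b) = a • gradLp hφ + b • gradLp hψ := by
  ext1
  filter_upwards [coeFn_gradLp (hφ.linComb hψ a b), coeFn_gradLp hφ, coeFn_gradLp hψ,
    Lp.coeFn_add (a • gradLp hφ) (b • gradLp hψ), Lp.coeFn_smul a (gradLp hφ),
    Lp.coeFn_smul b (gradLp hψ)] with x h1 h2 h3 h4 h5 h6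
  rw [h1, h4, Pi.add_apply, h5, h6, Pi.smul_apply, Pi.smul_apply, h2, h3,
    hφ.gradient_linComb hψ]

/-- The gradients of the test functions that are bounded by `s`. -/
def testGrads (A : Set (Euc N)) (s : ℝ) : Set (L2Vec A) :=
  {g | ∃ φ, ∃ hφ : IsTest A φ, (∀ x, |φ x| ≤ s) ∧ gradLp hφ = g}

theorem testGrads_eq_smul {s : ℝ} (hs : 0 < s) : testGrads A s = s • testGrads A 1 := by
  have key : ∀ (r c : ℝ), 0 < c → ∀ g ∈ testGrads A r, c • g ∈ testGrads A (c * r) := by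
    rintro r c hc _ ⟨φ, hφ, hb, rfl⟩
    refine ⟨_, hφ.linComb hφ c 0, fun x => ?_, by rw [gradLp_linComb hφ hφ]; simp⟩
    rw [zero_mul, add_zero, abs_mul, abs_of_pos hc]
    exact mul_le_mul_of_nonneg_left (hb x) hc.le
  ext g
  constructor
  · intro hg
    refine ⟨s⁻¹ • g, ?_, smul_inv_smul₀ hs.ne' g⟩
    simpa [inv_mul_cancel₀ hs.ne'] using key s s⁻¹ (by positivity) g hg
  · rintro ⟨k, hk, rfl⟩
    simpa using key 1 s hs k hk

/-- The closure in `L²` of the gradients of the test functions that are bounded by `1`. -/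
def gradBall (A : Set (Euc N)) : Set (L2Vec A) := closure (testGrads A 1)

theorem smul_gradBall {s : ℝ} (hs : 0 < s) : s • gradBall A = closure (testGrads A s) := by
  rw [gradBall, ← closure_smul₀' hs.ne', ← testGrads_eq_smul hs]

theorem isClosed_gradBall : IsClosed (gradBall A) := isClosed_closure

theorem convex_gradBall : Convex ℝ (gradBall A) := by
  refine Convex.closure ?_
  rintro _ ⟨φ, hφ, hb, rfl⟩ _ ⟨ψ, hψ, hb', rfl⟩ a b ha hb0 hab
  refine ⟨_, hφ.linComb hψ a b, fun x => ?_, gradLp_linComb hφ hψ a b⟩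
  have h1 := abs_add_le (a * φ x) (b * ψ x)
  rw [abs_mul, abs_mul, abs_of_nonneg ha, abs_of_nonneg hb0] at h1
  nlinarith [hb x, hb' x]

theorem neg_mem_gradBall {k : L2Vec A} (hk : k ∈ gradBall A) : -k ∈ gradBall A := by
  refine map_mem_closure continuous_neg hk ?_
  rintro _ ⟨φ, hφ, hb, rfl⟩
  refine ⟨_, hφ.linComb hφ (-1) 0, fun x => ?_, by rw [gradLp_linComb hφ hφ]; simp⟩
  simpa using hb x

theorem zero_mem_gradBall : (0 : L2Vec A) ∈ gradBall A := by
  refine subset_closure ⟨_, (IsTest.zero (A := A)).linComb IsTest.zero 0 0, fun x => by simp, ?_⟩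
  rw [gradLp_linComb IsTest.zero IsTest.zero]; simp

theorem hasFDerivAt_softClamp_comp {μ ε : ℝ} (hε : 0 < ε) {x : Euc N} {L : Euc N →L[ℝ] ℝ}
    (hf : HasFDerivAt f L x) :
    HasFDerivAt (fun x => softClamp μ ε (f x)) (softClampDeriv μ ε (f x) • L) x :=
  (hasDerivAt_softClamp hε (f x)).comp_hasFDerivAt x hf

/-- The strict margin `η` makes room for the error of the smooth truncation; it is obtained by
shrinking a test function by a factor `1 - c`. -/
theorem exists_strict_approx {s : ℝ} (hs : 0 < s) {a : L2Vec A} (ha : a ∈ s • gradBall A)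
    {δ : ℝ} (hδ : 0 < δ) : ∃ φ, ∃ hφ : IsTest A φ, (∃ η, 0 < η ∧ ∀ x, |φ x| ≤ s - η) ∧
      ‖gradLp hφ - a‖ ≤ δ := by
  rw [smul_gradBall hs] at ha
  obtain ⟨_, ⟨φ, hφ, hb, rfl⟩, hd⟩ := Metric.mem_closure_iff.1 ha (δ / 2) (by positivity)
  set c : ℝ := δ / 2 / (‖gradLp hφ‖ + δ) with hc
  have hden : 0 < ‖gradLp hφ‖ + δ := by positivity
  have hc0 : 0 < c := by positivity
  have hc1 : c ≤ 1 := by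
    rw [hc, div_le_one hden]; linarith [norm_nonneg (gradLp hφ)]
  refine ⟨_, hφ.linComb hφ (1 - c) 0, ⟨c * s, by positivity, fun x => ?_⟩, ?_⟩
  · rw [zero_mul, add_zero, abs_mul, abs_of_nonneg (by linarith)]
    nlinarith [hb x]
  · rw [gradLp_linComb hφ hφ, zero_smul, add_zero, sub_smul, one_smul, sub_right_comm]
    refine (norm_sub_le _ _).trans ?_
    rw [norm_smul, Real.norm_of_nonneg hc0.le]
    rw [dist_comm, dist_eq_norm] at hd
    have : c * ‖gradLp hφ‖ ≤ δ / 2 := by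
      rw [hc, div_mul_eq_mul_div, div_le_iff₀ hden]
      nlinarith [norm_nonneg (gradLp hφ)]
    linarith

/-- Here `θ` is the smooth truncation of `ψ - φ`. It serves both the comparison principle and, with
`φ = 0`, the truncation of approximations in H¹₀. -/
theorem exists_softClamp_sub (hφ : IsTest A φ) (hψ : IsTest A ψ) {μ ε : ℝ} (hε : 0 < ε)
    (hμ : 0 ≤ μ) : ∃ θ c : Euc N → ℝ, IsTest A θ ∧
      (c = fun x => softClampDeriv μ ε (ψ x - φ x)) ∧ (∀ x, c x ∈ Icc (0 : ℝ) 1) ∧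
      (∀ x, |θ x| ≤ μ) ∧
      (∀ x s, |φ x| ≤ s - ε → |ψ x| ≤ s + μ - ε → |ψ x - θ x| ≤ s) ∧
      ∀ x, gradient θ x = c x • gradient ψ x + (-c x) • gradient φ x := by
  have hsm : ContDiff ℝ ∞ fun x => softClamp μ ε (ψ x - φ x) :=
    (contDiff_softClamp hε).comp (hψ.1.sub hφ.1)
  refine ⟨fun x => softClamp μ ε (ψ x - φ x), fun x => softClampDeriv μ ε (ψ x - φ x),
    hφ.of_support hψ hsm fun x h1 h2 => by simp [h1, h2, softClamp_zero], rfl,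
    fun x => softClampDeriv_mem hε hμ _, fun x => abs_softClamp_le hε hμ _,
    fun x s h1 h2 => abs_sub_softClamp_le hε hμ h1 h2, fun x => ?_⟩
  refine gradient_eq_of_hasFDerivAt ?_
  convert! hasFDerivAt_softClamp_comp (μ := μ) hε ((hψ.hasFDerivAt x).sub (hφ.hasFDerivAt x))
    using 1
  rw [smul_sub, neg_smul, sub_eq_add_neg]
  rfl

/-- Take `m = ∇(φ + θ)` and `M = ∇(ψ - θ)`. Pointwise `m - M = (1 - 2c)(∇φ - ∇ψ)` with `c ∈ [0, 1]`,
so the distance does not grow. -/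
theorem hasClampProperty_gradBall : HasClampProperty (gradBall A) := by
  intro s h hs hh a ha b hb δ hδ
  obtain ⟨φ, hφ, ⟨η, hη, hφb⟩, hφa⟩ := exists_strict_approx hs ha hδ
  obtain ⟨ψ, hψ, ⟨η', hη', hψb⟩, hψa⟩ := exists_strict_approx (by positivity) hb hδ
  set ε := min η η' with hεdef
  have hε : 0 < ε := lt_min hη hη'
  obtain ⟨θ, c, hθ, -, hc, hθb, hM, gθ⟩ := exists_softClamp_sub hφ hψ hε hh.le
  refine ⟨gradLp hφ, gradLp hψ, gradLp (hφ.linComb hθ 1 1), gradLp (hψ.linComb hθ 1 (-1)),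
    hφa, hψa, ?_, ?_, ?_, ?_, ?_⟩
  · rw [smul_gradBall (by positivity)]
    refine subset_closure ⟨_, hφ.linComb hθ 1 1, fun x => ?_, rfl⟩
    rw [one_mul, one_mul]
    exact (abs_add_le _ _).trans (add_le_add ((hφb x).trans (by linarith))
      (hθb x))
  · rw [smul_gradBall hs]
    refine subset_closure ⟨_, hψ.linComb hθ 1 (-1), fun x => ?_, rfl⟩
    rw [one_mul, neg_one_mul, ← sub_eq_add_neg]
    exact hM x s ((hφb x).trans (by linarith [min_le_left η η']))
      ((hψb x).trans (by linarith [min_le_right η η']))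
  · rw [smul_gradBall hh, gradLp_linComb hφ hθ, one_smul, one_smul, add_sub_cancel_left]
    exact subset_closure ⟨_, hθ, hθb, rfl⟩
  · simp only [gradLp_linComb hφ hθ, gradLp_linComb hψ hθ, one_smul, neg_smul]
    abel
  · have e : gradLp (hφ.linComb hθ 1 1) - gradLp (hψ.linComb hθ 1 (-1)) =
        (gradLp hφ - gradLp hψ) + (2 : ℝ) • gradLp hθ := by
      simp only [gradLp_linComb hφ hθ, gradLp_linComb hψ hθ, one_smul, neg_smul, two_smul]
      abel
    rw [e]
    refine Lp.norm_le_norm_of_ae_le ?_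
    filter_upwards [coeFn_gradLp hφ, coeFn_gradLp hψ, coeFn_gradLp hθ,
      Lp.coeFn_add (gradLp hφ - gradLp hψ) ((2 : ℝ) • gradLp hθ),
      Lp.coeFn_sub (gradLp hφ) (gradLp hψ), Lp.coeFn_smul (2 : ℝ) (gradLp hθ)]
      with x h1 h2 h3 h4 h5 h6
    rw [h4, Pi.add_apply, h5, h6, Pi.sub_apply, Pi.smul_apply, h1, h2, h3, gθ]
    have e2 : gradient φ x - gradient ψ x + (2 : ℝ) • (c x • gradient ψ x + -c x • gradient φ x) =
        (1 - 2 * c x) • (gradient φ x - gradient ψ x) := by module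
    have hc := hc x
    rw [e2, norm_smul]
    refine mul_le_of_le_one_left (norm_nonneg _) ?_
    rw [Real.norm_eq_abs, abs_le]
    constructor <;> linarith [hc.1, hc.2]

end Test

/-! ### The divergence mass as a support function, its subgradient and its flow -/

section Divergence

variable {N : ℕ} {A : Set (Euc N)} {φ ψ : Euc N → ℝ}

/-- Integration by parts moves the derivative to `ψ`. The bound does not depend on `φ`, so the
fields `ψ • c` are bounded on `gradBall A`. -/
theorem abs_integral_smul_gradient_le (hφ : IsTest A φ) (hb : ∀ x, |φ x| ≤ 1) (hψ : IsTest A ψ)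
    (c : Euc N) :
    |∫ x in A, ⟪gradient φ x, ψ x • c⟫| ≤ ∫ x, |fderiv ℝ ψ x c| := by
  have hz : ∀ x ∉ A, ψ x = 0 := fun x hx =>
    image_eq_zero_of_notMem_tsupport fun h => hx (hψ.2.2 h)
  rw [setIntegral_eq_integral_of_forall_compl_eq_zero (fun x hx => by simp [hz x hx])]
  have hcf : ∀ {θ : Euc N → ℝ}, IsTest A θ → Continuous fun x => fderiv ℝ θ x c := fun hθ =>
    (hθ.1.continuous_fderiv (by simp)).clm_apply continuous_const
  have hcs : HasCompactSupport fun x => fderiv ℝ ψ x c :=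
    (hψ.2.1.fderiv (𝕜 := ℝ)).mono fun x hx hx' => hx (by simp [hx'])
  have e : ∀ x, ⟪gradient φ x, ψ x • c⟫ = ψ x * fderiv ℝ φ x c := by
    intro x
    rw [real_inner_smul_right]
    simp [gradient]
  simp only [e]
  have hI : Integrable fun x => fderiv ℝ ψ x c := (hcf hψ).integrable_of_hasCompactSupport hcs
  have hI2 : Integrable fun x => fderiv ℝ ψ x c * φ x :=
    ((hcf hψ).mul hφ.1.continuous).integrable_of_hasCompactSupport hcs.mul_right
  rw [integral_mul_fderiv_eq_neg_fderiv_mul_of_integrable hI2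
    ((hψ.1.continuous.mul (hcf hφ)).integrable_of_hasCompactSupport hψ.2.1.mul_right)
    ((hψ.1.continuous.mul hφ.1.continuous).integrable_of_hasCompactSupport hψ.2.1.mul_right)
    (fun x _ => (hψ.hasFDerivAt x).differentiableAt)
    (fun x _ => (hφ.hasFDerivAt x).differentiableAt), abs_neg]
  refine (abs_integral_le_integral_abs).trans (integral_mono hI2.abs hI.abs fun x => ?_)
  simp only [abs_mul]
  exact mul_le_of_le_one_right (abs_nonneg _) (hb x)

/-- A vector orthogonal to all the fields `ψ • c` vanishes almost everywhere, by the fundamental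
lemma of the calculus of variations. -/
theorem dense_boundedOn_gradBall (hA : IsOpen A) :
    Dense (boundedOn (gradBall A) : Set (L2Vec A)) := by
  rw [Submodule.dense_iff_topologicalClosure_eq_top, Submodule.topologicalClosure_eq_top_iff,
    Submodule.eq_bot_iff]
  intro h hh
  rw [Submodule.mem_orthogonal] at hh
  have hmem : ∀ ψ : Euc N → ℝ, IsTest A ψ → ∀ c : Euc N, ∫ x in A, ⟪ψ x • c, h x⟫ = 0 := by
    intro ψ hψ c
    have hL : MemLp (fun x => ψ x • c) 2 (volume.restrict A) := by
      refine ((hψ.1.continuous.smul continuous_const).memLp_of_hasCompactSupport ?_).restrict A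
      exact hψ.2.1.smul_right (f' := fun _ => c)
    rw [← hh (hL.toLp _) ⟨∫ x, |fderiv ℝ ψ x c|, fun k hk => ?_⟩, L2.inner_def]
    · refine integral_congr_ae ?_
      filter_upwards [hL.coeFn_toLp] with x hx
      rw [hx]
    · have hcl : IsClosed {k : L2Vec A | |⟪k, hL.toLp _⟫| ≤ ∫ x, |fderiv ℝ ψ x c|} :=
        isClosed_le (continuous_id.inner continuous_const).abs continuous_const
      refine closure_minimal ?_ hcl hk
      rintro _ ⟨φ, hφ, hb, rfl⟩
      rw [mem_ofPred_eq, L2.inner_def]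
      refine le_of_eq_of_le (congrArg _ (integral_congr_ae ?_))
        (abs_integral_smul_gradient_le hφ hb hψ c)
      filter_upwards [hL.coeFn_toLp, coeFn_gradLp hφ] with x h1 h2
      rw [h1, h2]
  have hloc : LocallyIntegrable h (volume.restrict A) := (Lp.memLp h).locallyIntegrable (by simp)
  have hae := hA.ae_eq_zero_of_integral_contDiff_smul_eq_zero (μ := volume.restrict A)
    (hloc.locallyIntegrableOn A) fun ψ h1 h2 h3 => by
      have hψ : IsTest A ψ := ⟨h1, h2, h3⟩
      have hI : Integrable (fun x => ψ x • h x) (volume.restrict A) :=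
        memLp_one_iff_integrable.1 ((Lp.memLp h).smul hψ.memLp)
      refine ext_inner_left ℝ fun c => ?_
      rw [← integral_inner hI, inner_zero_right, ← hmem ψ hψ c]
      refine integral_congr_ae (Eventually.of_forall fun x => ?_)
      simp only [real_inner_smul_left, real_inner_smul_right]
  ext1
  filter_upwards [hae, ae_restrict_mem hA.measurableSet,
    Lp.coeFn_zero (Euc N) 2 (volume.restrict A)] with x h1 h2 h3
  rw [h1 h2, h3, Pi.zero_apply]

theorem inner_le_divMass (u : L2Vec A) {k : L2Vec A} (hk : k ∈ gradBall A) :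
    ((⟪k, u⟫ : ℝ) : EReal) ≤ divMass A u := by
  have hcl : IsClosed {k : L2Vec A | ((⟪k, u⟫ : ℝ) : EReal) ≤ divMass A u} :=
    isClosed_le (continuous_coe_real_ereal.comp (continuous_id.inner continuous_const))
      continuous_const
  refine closure_minimal ?_ hcl hk
  rintro _ ⟨φ, hφ, hb, rfl⟩
  have hψ := hφ.linComb hφ (-1) 0
  have hmem : (fun x => -1 * φ x + 0 * φ x) ∈
      {φ : Euc N → ℝ | IsTest A φ ∧ ∀ x, |φ x| ≤ 1} := ⟨hψ, fun x => by simpa using hb x⟩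
  refine le_trans (le_of_eq ?_) (le_iSup₂ (f := fun (φ : Euc N → ℝ)
    (_ : φ ∈ {φ : Euc N → ℝ | IsTest A φ ∧ ∀ x, |φ x| ≤ 1}) =>
      ((∫ x in A, -⟪u x, gradient φ x⟫ : ℝ) : EReal)) _ hmem)
  rw [L2.inner_def]
  congr 1
  refine integral_congr_ae ?_
  filter_upwards [coeFn_gradLp hφ] with x hx
  rw [hx, hφ.gradient_linComb hφ, zero_smul, add_zero, neg_one_smul, inner_neg_right, neg_neg,
    real_inner_comm]

theorem divMass_le {u : L2Vec A} {c : EReal}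
    (h : ∀ k ∈ gradBall A, ((⟪k, u⟫ : ℝ) : EReal) ≤ c) : divMass A u ≤ c := by
  refine iSup₂_le fun φ hφ => ?_
  refine le_trans (le_of_eq ?_) (h _ (neg_mem_gradBall (subset_closure ⟨φ, hφ.1, hφ.2, rfl⟩)))
  rw [inner_neg_left, L2.inner_def, ← integral_neg]
  congr 1
  refine integral_congr_ae ?_
  filter_upwards [coeFn_gradLp hφ.1] with x hx
  rw [hx, real_inner_comm]

theorem divMass_eq_of_mem_face {u p : L2Vec A} (hp : p ∈ face (gradBall A) u) :
    divMass A u = ((⟪p, u⟫ : ℝ) : EReal) :=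
  le_antisymm (divMass_le fun k hk => EReal.coe_le_coe_iff.2 (hp.2 k hk))
    (inner_le_divMass u hp.1)

theorem mem_subgrad_of_mem_face {u p : L2Vec A} (hp : p ∈ face (gradBall A) u) :
    p ∈ subgrad A u := by
  intro z
  rw [divMass_eq_of_mem_face hp, ← EReal.coe_add, inner_sub_right, add_sub_cancel]
  exact inner_le_divMass z hp.1

theorem divMass_zero : divMass A (0 : L2Vec A) = 0 := by
  refine le_antisymm (divMass_le fun k _ => by simp) ?_
  simpa using inner_le_divMass (0 : L2Vec A) zero_mem_gradBall

/-- Testing at `0` shows that 𝒟(u) is finite. With `g` the projection of `p` on the ball, testing at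
`u + (p - g)` and using subadditivity of the support function gives `⟪p - g, p - g⟫ ≤ 0`, so `p =
g`. -/
theorem mem_face_of_mem_subgrad {u p : L2Vec A} (hp : p ∈ subgrad A u) :
    p ∈ face (gradBall A) u := by
  have h0 : 0 ≤ divMass A u := by simpa using inner_le_divMass u zero_mem_gradBall
  have h1 := hp 0
  rw [divMass_zero, zero_sub, inner_neg_right] at h1
  have htop : divMass A u ≠ ⊤ := by
    intro h
    rw [h, EReal.top_add_coe] at h1
    exact absurd h1 (by simp)
  obtain ⟨r, hr⟩ : ∃ r : ℝ, divMass A u = r :=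
    ⟨_, (EReal.coe_toReal htop (ne_bot_of_le_ne_bot (by simp) h0)).symm⟩
  rw [hr, ← EReal.coe_add, ← EReal.coe_zero, EReal.coe_le_coe_iff] at h1
  have hk : ∀ k ∈ gradBall A, ⟪k, u⟫ ≤ r := fun k hk =>
    EReal.coe_le_coe_iff.1 (hr ▸ inner_le_divMass u hk)
  obtain ⟨g, hg, hgv⟩ := exists_proj (isClosed_gradBall (A := A)) convex_gradBall
    ⟨0, zero_mem_gradBall⟩ p
  have h2 : divMass A (u + (p - g)) ≤ ((r + ⟪g, p - g⟫ : ℝ) : EReal) := by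
    refine divMass_le fun k hkm => EReal.coe_le_coe_iff.2 ?_
    have := hgv k hkm
    rw [inner_sub_right, real_inner_comm, real_inner_comm g] at this
    rw [inner_add_right]
    linarith [hk k hkm]
  have h3 := (hp (u + (p - g))).trans h2
  rw [hr, ← EReal.coe_add, EReal.coe_le_coe_iff, add_sub_cancel_left] at h3
  have h4 : ⟪p - g, p - g⟫ ≤ 0 := by
    rw [inner_sub_left]; linarith
  have h5 : p = g := sub_eq_zero.1 (real_inner_self_nonpos.1 h4)
  exact ⟨h5 ▸ hg, fun k hkm => (hk k hkm).trans (by linarith)⟩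

theorem norm_sq_eq_integral {E : Type*} [NormedAddCommGroup E] [InnerProductSpace ℝ E]
    {α : Type*} [MeasurableSpace α] {μ : Measure α} (f : Lp E 2 μ) :
    ‖f‖ ^ 2 = ∫ x, ‖f x‖ ^ 2 ∂μ := by
  rw [← real_inner_self_eq_norm_sq, L2.inner_def]
  simp only [real_inner_self_eq_norm_sq]

theorem proxEnergy_eq (u₀ : L2Vec A) (t : ℝ) (z : L2Vec A) :
    proxEnergy A u₀ t z = divMass A z + ((1 / (2 * t) * ‖z - u₀‖ ^ 2 : ℝ) : EReal) := by
  rw [proxEnergy, norm_sq_eq_integral]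
  congr 3
  refine integral_congr_ae ?_
  filter_upwards [Lp.coeFn_sub z u₀] with x hx
  rw [hx, Pi.sub_apply]

/-- Bound 𝒟(z) below by `⟪p, z⟫`, with equality at `u`, and complete the square: the energy exceeds
its value at `u` by at least `‖z - u‖ ^ 2 / (2 * t)`. -/
theorem isMinOn_proxEnergy_iff {u₀ u p : L2Vec A} {t : ℝ} (ht : 0 < t)
    (hp : p ∈ face (gradBall A) u) (h : u₀ - u = t • p) (z : L2Vec A) :
    IsMinOn (proxEnergy A u₀ t) univ z ↔ z = u := by
  set E : ℝ := ⟪p, u⟫ + 1 / (2 * t) * ‖u - u₀‖ ^ 2 with hE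
  have hu : proxEnergy A u₀ t u = (E : EReal) := by
    rw [proxEnergy_eq, divMass_eq_of_mem_face hp, ← EReal.coe_add]
  have hz : ∀ z, ((E + 1 / (2 * t) * ‖z - u‖ ^ 2 : ℝ) : EReal) ≤ proxEnergy A u₀ t z := by
    intro z
    have e : E + 1 / (2 * t) * ‖z - u‖ ^ 2 = ⟪p, z⟫ + 1 / (2 * t) * ‖z - u₀‖ ^ 2 := by
      have e1 : z - u₀ = (z - u) - t • p := by rw [← h]; abel
      have e2 : u - u₀ = -(t • p) := by rw [← h]; abel
      have e3 := norm_sub_sq_real (z - u) (t • p)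
      rw [hE, e1, e2, norm_neg, e3, real_inner_smul_right, real_inner_comm p (z - u), inner_sub_right]
      field_simp
      ring
    rw [e, proxEnergy_eq, EReal.coe_add]
    gcongr
    exact inner_le_divMass z hp.1
  constructor
  · intro hmin
    have h1 := (hz z).trans ((isMinOn_iff.1 hmin u (mem_univ _)).trans_eq hu)
    rw [EReal.coe_le_coe_iff] at h1
    have h2 : 0 < 1 / (2 * t) := by positivity
    have h3 : ‖z - u‖ ^ 2 ≤ 0 := by nlinarith
    have h4 : ‖z - u‖ ^ 2 = 0 := le_antisymm h3 (sq_nonneg _)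
    exact sub_eq_zero.1 (by simpa using h4)
  · rintro rfl
    refine isMinOn_iff.2 fun y _ => ?_
    rw [hu]
    refine le_trans (EReal.coe_le_coe_iff.2 ?_) (hz y)
    have : 0 ≤ 1 / (2 * t) * ‖y - z‖ ^ 2 := by positivity
    linarith

theorem IsProjCurve.isGradientFlow {u₀ : L2Vec A} {G : ℝ → L2Vec A} (hA : IsOpen A)
    (hG : IsProjCurve (gradBall A) u₀ G) : IsGradientFlow A u₀ fun t => u₀ - G t := by
  obtain ⟨hlip, hder⟩ := hG.lipschitz_and_hasDerivAt isClosed_gradBall convex_gradBall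
  refine ⟨by simp [hG.zero], ContinuousOn.sub continuousOn_const fun t ht => ?_,
    fun a b ha hab => ?_, ?_⟩
  · rcases (mem_Ici.1 ht).eq_or_lt with rfl | ht
    · rw [ContinuousWithinAt, hG.zero]
      exact hG.tendsto_zero zero_mem_gradBall (dense_boundedOn_gradBall hA)
    · obtain ⟨C, hC⟩ := hlip (t / 2) (by positivity)
      exact ((hC.continuousOn t (mem_Ici.2 (by linarith))).continuousAt
        (Ici_mem_nhds (by linarith))).continuousWithinAt
  · obtain ⟨C, hC⟩ := hlip a ha
    refine LipschitzOnWith.absolutelyContinuousOnInterval (K := C) ?_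
    rw [uIcc_of_le hab]
    refine LipschitzOnWith.of_dist_le_mul fun s hs t ht => ?_
    rw [dist_sub_left]
    exact hC.dist_le_mul s hs.1 t ht.1
  · filter_upwards [hder] with t ⟨p, hp, hd⟩
    exact ⟨p, mem_subgrad_of_mem_face hp, hd.const_sub u₀⟩

theorem IsGradientFlow.eq {u₀ : L2Vec A} {u v : ℝ → L2Vec A} (hu : IsGradientFlow A u₀ u)
    (hv : IsGradientFlow A u₀ v) {t : ℝ} (ht : 0 ≤ t) : u t = v t := by
  refine sub_eq_zero.1 (eq_zero_of_dissipative (y := fun t => u t - v t)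
    (hu.continuousOn.sub hv.continuousOn)
    (fun a b ha hab => (hu.absCont a b ha hab).fun_sub (hv.absCont a b ha hab)) ?_
    (by simp [hu.initial, hv.initial]) ht)
  filter_upwards [hu.inclusion, hv.inclusion] with s ⟨p, hp, hpd⟩ ⟨q, hq, hqd⟩
  refine ⟨-p - -q, hpd.sub hqd, ?_⟩
  have hp := mem_face_of_mem_subgrad hp
  have hq := mem_face_of_mem_subgrad hq
  have h1 := hp.2 q hq.1
  have h2 := hq.2 p hp.1
  rw [real_inner_comm]
  simp only [inner_sub_left, inner_sub_right, inner_neg_left] at *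
  linarith

end Divergence

/-! ### Potentials in H¹₀, the Poincaré inequality and truncation -/

section Potential

variable {N : ℕ} {A : Set (Euc N)} {φ ψ : Euc N → ℝ}

/-- A test function as an element of `L²`. -/
noncomputable def testLp (hφ : IsTest A φ) : L2 A := hφ.memLp.toLp φ

theorem coeFn_testLp (hφ : IsTest A φ) : testLp hφ =ᵐ[volume.restrict A] φ :=
  hφ.memLp.coeFn_toLp

theorem mem_testGraph_iff {q : L2 A × L2Vec A} :
    q ∈ testGraph A ↔ ∃ φ, ∃ hφ : IsTest A φ, q = (testLp hφ, gradLp hφ) := by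
  constructor
  · rintro ⟨φ, hφ, h1, h2⟩
    exact ⟨φ, hφ, Prod.ext (Lp.ext (h1.trans (coeFn_testLp hφ).symm))
      (Lp.ext (h2.trans (coeFn_gradLp hφ).symm))⟩
  · rintro ⟨φ, hφ, rfl⟩
    exact ⟨φ, hφ, coeFn_testLp hφ, coeFn_gradLp hφ⟩

theorem testLp_linComb (hφ : IsTest A φ) (hψ : IsTest A ψ) (a b : ℝ) :
    testLp (hφ.linComb hψ a b) = a • testLp hφ + b • testLp hψ := by
  ext1
  filter_upwards [coeFn_testLp (hφ.linComb hψ a b), coeFn_testLp hφ, coeFn_testLp hψ,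
    Lp.coeFn_add (a • testLp hφ) (b • testLp hψ), Lp.coeFn_smul a (testLp hφ),
    Lp.coeFn_smul b (testLp hψ)] with x h1 h2 h3 h4 h5 h6
  rw [h1, h4, Pi.add_apply, h5, h6, Pi.smul_apply, Pi.smul_apply, h2, h3, smul_eq_mul, smul_eq_mul]

/-- The space `H^1_0(A)`, as the closure of the graph of the gradient on the test functions. -/
noncomputable def gradGraph (A : Set (Euc N)) : Submodule ℝ (L2 A × L2Vec A) :=
  Submodule.topologicalClosure
    { carrier := testGraph A
      zero_mem' := by
        refine mem_testGraph_iff.2 ⟨_, (IsTest.zero (A := A)).linComb IsTest.zero 0 0, ?_⟩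
        rw [testLp_linComb IsTest.zero IsTest.zero, gradLp_linComb IsTest.zero IsTest.zero]
        simp only [zero_smul, add_zero]
        rfl
      add_mem' := by
        intro p q hp hq
        obtain ⟨φ, hφ, rfl⟩ := mem_testGraph_iff.1 hp
        obtain ⟨ψ, hψ, rfl⟩ := mem_testGraph_iff.1 hq
        refine mem_testGraph_iff.2 ⟨_, hφ.linComb hψ 1 1, ?_⟩
        rw [testLp_linComb hφ hψ, gradLp_linComb hφ hψ]
        simp
      smul_mem' := by
        intro c p hp
        obtain ⟨φ, hφ, rfl⟩ := mem_testGraph_iff.1 hp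
        refine mem_testGraph_iff.2 ⟨_, hφ.linComb hφ c 0, ?_⟩
        rw [testLp_linComb hφ hφ, gradLp_linComb hφ hφ]
        simp }

theorem PoincareOn.exists_norm_le (hP : PoincareOn A) :
    ∃ c : NNReal, ∀ q ∈ closure (testGraph A), ‖q.1‖ ≤ c * ‖q.2‖ := by
  obtain ⟨C, hC⟩ := hP
  -- The sign of `C` is not prescribed, hence the absolute value.
  refine ⟨NNReal.sqrt (Real.nnabs C), fun q hq => ?_⟩
  refine closure_minimal ?_ (isClosed_le continuous_fst.norm
    (continuous_const.mul continuous_snd.norm)) hq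
  intro q hq
  obtain ⟨φ, hφ, rfl⟩ := mem_testGraph_iff.1 hq
  change ‖testLp hφ‖ ≤ (NNReal.sqrt (Real.nnabs C) : ℝ) * ‖gradLp hφ‖
  refine (pow_le_pow_iff_left₀ (norm_nonneg _) (by positivity) two_ne_zero).1 ?_
  rw [Real.coe_sqrt, Real.coe_nnabs, mul_pow, Real.sq_sqrt (abs_nonneg C), norm_sq_eq_integral, norm_sq_eq_integral]
  have e1 : ∫ x in A, ‖testLp hφ x‖ ^ 2 = ∫ x in A, φ x ^ 2 := by
    refine integral_congr_ae ?_
    filter_upwards [coeFn_testLp hφ] with x hx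
    rw [hx, Real.norm_eq_abs, sq_abs]
  have e2 : ∫ x in A, ‖gradLp hφ x‖ ^ 2 = ∫ x in A, ‖gradient φ x‖ ^ 2 := by
    refine integral_congr_ae ?_
    filter_upwards [coeFn_gradLp hφ] with x hx
    rw [hx]
  rw [e1, e2]
  exact (hC φ hφ).trans (mul_le_mul_of_nonneg_right (le_abs_self C)
    (integral_nonneg fun x => by positivity))

/-- The second projection is bounded below on `S`, so it has closed range and a continuous inverse
there; the orthogonal projection onto the range extends it to `F`. -/
theorem exists_continuousLinearMap_of_graph {E F : Type*} [NormedAddCommGroup E] [NormedSpace ℝ E]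
    [CompleteSpace E] [NormedAddCommGroup F] [InnerProductSpace ℝ F] [CompleteSpace F]
    (S : Submodule ℝ (E × F)) (hS : IsClosed (S : Set (E × F))) {c : NNReal}
    (h : ∀ q ∈ S, ‖q.1‖ ≤ c * ‖q.2‖) : ∃ T : F →L[ℝ] E, ∀ q ∈ S, T q.2 = q.1 := by
  have : CompleteSpace S := hS.completeSpace_coe
  set f : S →L[ℝ] F := (ContinuousLinearMap.snd ℝ E F).comp S.subtypeL with hf
  -- The product carries the sup norm, so the constant must control both components.
  have hanti : AntilipschitzWith (max c 1) f := by
    refine ContinuousLinearMap.antilipschitz_of_bound f fun q => ?_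
    change max ‖q.1.1‖ ‖q.1.2‖ ≤ _
    refine max_le ((h q.1 q.2).trans ?_) ?_
    · exact mul_le_mul_of_nonneg_right (by simp) (norm_nonneg _)
    · refine le_mul_of_one_le_left (norm_nonneg _) (by simp)
  have hcl : IsClosed (range f) := hanti.isClosed_range f.uniformContinuous
  have hR : IsClosed ((f : S →ₗ[ℝ] F).range : Set F) := by
    simpa [LinearMap.coe_range] using hcl
  have : CompleteSpace (f : S →ₗ[ℝ] F).range := hR.completeSpace_coe
  let e := ContinuousLinearMap.equivRange hanti.injective hcl
  refine ⟨((ContinuousLinearMap.fst ℝ E F).comp S.subtypeL).comp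
    ((e.symm : _ →L[ℝ] S).comp (f : S →ₗ[ℝ] F).range.orthogonalProjectionOnto), fun q hq => ?_⟩
  have h1 : (f : S →ₗ[ℝ] F).range.orthogonalProjectionOnto q.2 = e ⟨q, hq⟩ := by
    have : q.2 = ((e ⟨q, hq⟩ : (f : S →ₗ[ℝ] F).range) : F) := rfl
    rw [this, Submodule.orthogonalProjectionOnto_mem_subspace_eq_self]
  simp [h1]

theorem PoincareOn.exists_inverse_gradient (hP : PoincareOn A) :
    ∃ T : L2Vec A →L[ℝ] L2 A, ∀ q ∈ closure (testGraph A), T q.2 = q.1 := by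
  obtain ⟨c, hc⟩ := hP.exists_norm_le
  exact exists_continuousLinearMap_of_graph (gradGraph A) isClosed_closure hc

theorem isClosed_setOf_ae_abs_le {α : Type*} [MeasurableSpace α] {μ : Measure α} (s : ℝ) :
    IsClosed {f : Lp ℝ 2 μ | ∀ᵐ x ∂μ, |f x| ≤ s} := by
  refine IsSeqClosed.isClosed fun f g hf hg => ?_
  obtain ⟨ns, -, hns⟩ := (tendstoInMeasure_of_tendsto_Lp hg).exists_seq_tendsto_ae
  filter_upwards [hns, ae_all_iff.2 fun n => hf (ns n)] with x hx hb
  exact le_of_tendsto hx.abs (Eventually.of_forall hb)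

theorem inverse_gradient_mem_of_mem_smul {T : L2Vec A →L[ℝ] L2 A}
    (hT : ∀ q ∈ closure (testGraph A), T q.2 = q.1) {s : ℝ} (hs : 0 ≤ s) {g : L2Vec A}
    (hg : g ∈ s • gradBall A) :
    (T g, g) ∈ closure (testGraph A) ∧ ∀ᵐ x ∂(volume.restrict A), |T g x| ≤ s := by
  have hball : ∀ s, ∀ g ∈ closure (testGrads A s),
      (T g, g) ∈ closure (testGraph A) ∧ ∀ᵐ x ∂(volume.restrict A), |T g x| ≤ s := by
    intro s g hg
    have hcl : IsClosed {g : L2Vec A | (T g, g) ∈ closure (testGraph A) ∧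
        ∀ᵐ x ∂(volume.restrict A), |T g x| ≤ s} :=
      (isClosed_closure.preimage (T.continuous.prodMk continuous_id)).inter
        ((isClosed_setOf_ae_abs_le s).preimage T.continuous)
    refine closure_minimal ?_ hcl hg
    rintro _ ⟨φ, hφ, hb, rfl⟩
    have hmem : (testLp hφ, gradLp hφ) ∈ closure (testGraph A) :=
      subset_closure (mem_testGraph_iff.2 ⟨φ, hφ, rfl⟩)
    have e : T (gradLp hφ) = testLp hφ := hT _ hmem
    rw [mem_ofPred_eq, e]
    refine ⟨hmem, ?_⟩
    filter_upwards [coeFn_testLp hφ] with x hx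
    rw [hx]; exact hb x
  rcases hs.eq_or_lt with rfl | hs
  · obtain ⟨k, -, rfl⟩ := hg
    simp only [zero_smul, map_zero]
    refine ⟨(gradGraph A).zero_mem, ?_⟩
    filter_upwards [Lp.coeFn_zero ℝ 2 (volume.restrict A)] with x hx
    rw [hx, Pi.zero_apply, abs_zero]
  · rw [smul_gradBall hs] at hg
    exact hball s g hg

/-- Truncate the approximating test functions smoothly at level `μ`. Their gradients are multiplied
by factors `c n` in `[0, 1]`, which tend to `1` a.e. along a subsequence because `|f| ≤ t < μ`. -/
theorem mem_closure_testGrads_of_ae_abs_le {f : L2 A} {h : L2Vec A}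
    (hfh : (f, h) ∈ closure (testGraph A)) {t μ : ℝ} (ht0 : 0 ≤ t) (ht : t < μ)
    (hb : ∀ᵐ x ∂(volume.restrict A), |f x| ≤ t) : h ∈ closure (testGrads A μ) := by
  obtain ⟨q, hq, hlim⟩ := mem_closure_iff_seq_limit.1 hfh
  choose φ hφ hqe using fun n => mem_testGraph_iff.1 (hq n)
  have h1 : Tendsto (fun n => testLp (hφ n)) atTop (𝓝 f) := by
    have := (continuous_fst.tendsto _).comp hlim
    simpa [Function.comp_def, hqe] using this
  have h2 : Tendsto (fun n => gradLp (hφ n)) atTop (𝓝 h) := by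
    have := (continuous_snd.tendsto _).comp hlim
    simpa [Function.comp_def, hqe] using this
  obtain ⟨ns, hmono, hns⟩ := (tendstoInMeasure_of_tendsto_Lp h1).exists_seq_tendsto_ae
  have hr : ∀ n : ℕ, 0 < 1 / ((n : ℝ) + 1) := fun n => by positivity
  choose θ c hθ hc hc01 hθb _ hgθ using fun n =>
    exists_softClamp_sub (IsTest.zero (A := A)) (hφ (ns n)) (hr n) (ht0.trans ht.le)
  have hgθ' : ∀ n x, gradient (θ n) x = c n x • gradient (φ (ns n)) x := by
    intro n x
    rw [hgθ n x]
    have : gradient (fun _ : Euc N => (0 : ℝ)) x = 0 := by simp [gradient]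
    rw [this, smul_zero, add_zero]
  have hcm : ∀ n, Continuous (c n) := by
    intro n
    rw [hc n]
    have := (hφ (ns n)).1.continuous
    have hpos : ∀ y : ℝ, √(y ^ 2 + (1 / ((n : ℝ) + 1)) ^ 2) ≠ 0 := fun y => by
      have := hr n
      positivity
    unfold softClampDeriv
    refine Continuous.div_const (Continuous.sub ?_ ?_) 2
    · exact Continuous.div (by fun_prop) (by fun_prop) fun x => hpos _
    · exact Continuous.div (by fun_prop) (by fun_prop) fun x => hpos _
  have hhI : Integrable (fun x => ‖h x‖ ^ 2) (volume.restrict A) :=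
    (Lp.memLp h).integrable_norm_pow two_ne_zero
  have hlimI : Tendsto (fun n => ∫ x in A, (1 - c n x) ^ 2 * ‖h x‖ ^ 2) atTop (𝓝 0) := by
    have hdc := tendsto_integral_of_dominated_convergence (μ := volume.restrict A)
      (F := fun n x => (1 - c n x) ^ 2 * ‖h x‖ ^ 2) (f := fun _ => (0 : ℝ))
      (fun x => ‖h x‖ ^ 2) (fun n => ?_) hhI (fun n => ?_) ?_
    · simpa using hdc
    · exact (((continuous_const.sub (hcm n)).pow 2).aestronglyMeasurable).mul
        hhI.aestronglyMeasurable
    · refine Eventually.of_forall fun x => ?_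
      rw [Real.norm_of_nonneg (by positivity)]
      refine mul_le_of_le_one_left (by positivity) ?_
      nlinarith [(hc01 n x).1, (hc01 n x).2]
    · filter_upwards [hns, hb, ae_all_iff.2 fun n => coeFn_testLp (hφ (ns n))] with x hx hbx he
      simp only [he] at hx
      have := tendsto_softClampDeriv ht hbx hx
        (tendsto_one_div_add_atTop_nhds_zero_nat (𝕜 := ℝ))
      have h3 : Tendsto (fun n => c n x) atTop (𝓝 1) := by
        simpa [hc] using this
      simpa using ((h3.const_sub 1).pow 2).mul_const (‖h x‖ ^ 2)
  refine mem_closure_of_tendsto (f := fun n => gradLp (hθ n)) (b := atTop)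
    (tendsto_of_sq_norm_le (r := fun n => 2 * ‖gradLp (hφ (ns n)) - h‖ ^ 2 +
      2 * ∫ x in A, (1 - c n x) ^ 2 * ‖h x‖ ^ 2) (Eventually.of_forall fun n => ?_) ?_)
    (Eventually.of_forall fun n => ⟨θ n, hθ n, hθb n, rfl⟩)
  · have hI1 : Integrable (fun x => ‖(gradLp (hφ (ns n)) - h : L2Vec A) x‖ ^ 2)
        (volume.restrict A) := (Lp.memLp _).integrable_norm_pow two_ne_zero
    have hI2 : Integrable (fun x => (1 - c n x) ^ 2 * ‖h x‖ ^ 2) (volume.restrict A) := by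
      refine hhI.mono ((((continuous_const.sub (hcm n)).pow 2).aestronglyMeasurable).mul
        hhI.aestronglyMeasurable) (Eventually.of_forall fun x => ?_)
      rw [Real.norm_of_nonneg (by positivity), Real.norm_of_nonneg (by positivity)]
      refine mul_le_of_le_one_left (by positivity) ?_
      nlinarith [(hc01 n x).1, (hc01 n x).2]
    rw [norm_sq_eq_integral, norm_sq_eq_integral, ← integral_const_mul, ← integral_const_mul,
      ← integral_add (hI1.const_mul 2) (hI2.const_mul 2)]
    refine integral_mono_ae ((Lp.memLp _).integrable_norm_pow two_ne_zero)
      ((hI1.const_mul 2).add (hI2.const_mul 2)) ?_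
    filter_upwards [coeFn_gradLp (hφ (ns n)), coeFn_gradLp (hθ n),
      Lp.coeFn_sub (gradLp (hφ (ns n))) h, Lp.coeFn_sub (gradLp (hθ n)) h] with x e1 e2 e3 e4
    rw [e3, e4, Pi.sub_apply, Pi.sub_apply, e1, e2, hgθ']
    -- The first term is controlled by L² convergence of the gradients, the second by dominated
    -- convergence against the fixed field `h`.
    have e5 : c n x • gradient (φ (ns n)) x - h x =
        c n x • (gradient (φ (ns n)) x - h x) - (1 - c n x) • h x := by module
    rw [e5]
    have h6 := norm_sub_le (c n x • (gradient (φ (ns n)) x - h x)) ((1 - c n x) • h x)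
    rw [norm_smul, norm_smul, Real.norm_of_nonneg (hc01 n x).1,
      Real.norm_of_nonneg (by linarith [(hc01 n x).2])] at h6
    have h7 : c n x * ‖gradient (φ (ns n)) x - h x‖ ≤ ‖gradient (φ (ns n)) x - h x‖ :=
      mul_le_of_le_one_left (norm_nonneg _) (hc01 n x).2
    have h8 := h6.trans (add_le_add_left h7 _)
    have h9 := pow_le_pow_left₀ (norm_nonneg _) h8 2
    rw [← mul_pow]
    nlinarith [sq_nonneg (‖gradient (φ (ns n)) x - h x‖ - (1 - c n x) * ‖h x‖)]
  · have h3 := (tendsto_iff_norm_sub_tendsto_zero.1 h2).comp hmono.tendsto_atTop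
    simpa [Function.comp_def] using ((h3.pow 2).const_mul 2).add (hlimI.const_mul 2)

theorem mem_smul_of_forall_gt {H : Type*} [NormedAddCommGroup H] [InnerProductSpace ℝ H]
    {K : Set H} (hK : IsClosed K) (h0 : (0 : H) ∈ K) (hd : Dense (boundedOn K : Set H)) {t : ℝ}
    (ht : 0 ≤ t) {h : H} (hh : ∀ μ, t < μ → h ∈ μ • K) : h ∈ t • K := by
  rcases ht.eq_or_lt with rfl | ht
  · rw [eq_zero_of_forall_mem_smul hd hh]
    exact ⟨0, h0, by simp⟩
  · have hlim : Tendsto (fun μ : ℝ => (t / μ) • h) (𝓝[>] t) (𝓝 h) := by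
      have : Tendsto (fun μ : ℝ => (t / μ) • h) (𝓝 t) (𝓝 ((t / t) • h)) :=
        (tendsto_const_nhds.div tendsto_id ht.ne').smul_const h
      rw [div_self ht.ne', one_smul] at this
      exact this.mono_left nhdsWithin_le_nhds
    refine (isClosed_smul_set hK h0 t).mem_of_tendsto hlim ?_
    filter_upwards [self_mem_nhdsWithin] with μ hμ
    obtain ⟨k, hk, rfl⟩ := hh μ hμ
    refine ⟨k, hk, ?_⟩
    simp only [smul_smul]
    rw [div_mul_cancel₀ _ (ht.trans hμ).ne']

/-- Truncation works at every level `μ > t`; closedness brings it down to `t`, with density of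
`boundedOn` needed only for `t = 0`. -/
theorem HasGradH10.mem_smul_gradBall (hA : IsOpen A) {z : Euc N → ℝ} {h : L2Vec A}
    (hz : HasGradH10 A z h) {t : ℝ} (ht : 0 ≤ t)
    (hb : ∀ᵐ x ∂(volume.restrict A), |z x| ≤ t) : h ∈ t • gradBall A := by
  obtain ⟨f, hf, hfh⟩ := hz
  refine mem_smul_of_forall_gt isClosed_gradBall zero_mem_gradBall (dense_boundedOn_gradBall hA) ht
    fun μ hμ => ?_
  rw [smul_gradBall (ht.trans_lt hμ)]
  refine mem_closure_testGrads_of_ae_abs_le hfh ht hμ ?_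
  filter_upwards [hf, hb] with x h1 h2
  rwa [h1]

end Potential

/-! ### Jointly measurable representatives -/

section JointMeasurability

/-- A strongly measurable curve in `L²` has a jointly measurable representative. -/
theorem exists_jointly_stronglyMeasurable {α β : Type*} [MeasurableSpace α] [MeasurableSpace β]
    {μ : Measure β} [TopologicalSpace.SeparableSpace (Lp ℝ 2 μ)] {F : α → Lp ℝ 2 μ}
    (hF : StronglyMeasurable F) :
    ∃ v : α → β → ℝ, StronglyMeasurable (Function.uncurry v) ∧ ∀ t, v t =ᵐ[μ] F t := by
  classical
  set D := TopologicalSpace.denseSeq (Lp ℝ 2 μ)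
  have hex : ∀ (n : ℕ) (t : α), ∃ k, dist (F t) (D k) < (1 / 2 : ℝ) ^ n := fun n t => by
    obtain ⟨k, hk⟩ := (TopologicalSpace.denseRange_denseSeq (Lp ℝ 2 μ)).exists_dist_lt
      (F t) (show 0 < (1 / 2 : ℝ) ^ n by positivity)
    exact ⟨k, hk⟩
  set K : ℕ → α → ℕ := fun n t => Nat.find (hex n t)
  have hKspec : ∀ n t, dist (F t) (D (K n t)) < (1 / 2 : ℝ) ^ n := fun n t =>
    Nat.find_spec (hex n t)
  have hKm : ∀ n, Measurable (K n) := fun n => measurable_find (hex n) fun k =>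
    (hF.dist stronglyMeasurable_const).measurable measurableSet_Iio
  have hDm : Measurable fun p : ℕ × β => D p.1 p.2 :=
    measurable_from_prod_countable_right fun k => (Lp.stronglyMeasurable (D k)).measurable
  refine ⟨fun t x => limUnder atTop fun n => D (K n t) x, ?_, fun t => ?_⟩
  · refine StronglyMeasurable.limUnder (f := fun n (p : α × β) => D (K n p.1) p.2) fun n => ?_
    exact (hDm.comp (((hKm n).comp measurable_fst).prodMk measurable_snd)).stronglyMeasurable
  · have hlim : Tendsto (fun n => D (K n t)) atTop (𝓝 (F t)) := by
      rw [tendsto_iff_dist_tendsto_zero]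
      refine squeeze_zero (fun n => dist_nonneg) (fun n => ?_)
        (tendsto_pow_atTop_nhds_zero_of_lt_one (r := (1 / 2 : ℝ)) (by norm_num) (by norm_num))
      rw [dist_comm]
      exact (hKspec n t).le
    obtain ⟨ns, hmono, hns⟩ := (tendstoInMeasure_of_tendsto_Lp hlim).exists_seq_tendsto_ae
    -- The summable rate gives a.e. convergence of the whole sequence, so `limUnder` is a true
    -- limit; the subsequence only identifies it.
    have hcau := Lp.ae_tendsto_of_cauchy_eLpNorm (μ := μ) (p := 2) (f := fun n => D (K n t))
      (B := fun n => ENNReal.ofReal (2 * (1 / 2) ^ n)) (fun n => Lp.aestronglyMeasurable _)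
      (by simp) ?_ fun M n m hn hm => ?_
    · filter_upwards [hcau, hns] with x ⟨l, hl⟩ hx
      have : l = F t x := tendsto_nhds_unique (hl.comp hmono.tendsto_atTop) hx
      rw [← this]
      exact hl.limUnder_eq
    · rw [← ENNReal.ofReal_tsum_of_nonneg (fun n => by positivity)
        (summable_geometric_two.mul_left 2)]
      exact ENNReal.ofReal_ne_top
    · rw [← Lp.edist_def, edist_dist, ENNReal.ofReal_lt_ofReal_iff (by positivity)]
      have h1 := dist_triangle_left (D (K n t)) (D (K m t)) (F t)
      have h2 : (1 / 2 : ℝ) ^ n ≤ (1 / 2) ^ M :=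
        pow_le_pow_of_le_one (by norm_num) (by norm_num) hn
      have h3 : (1 / 2 : ℝ) ^ m ≤ (1 / 2) ^ M :=
        pow_le_pow_of_le_one (by norm_num) (by norm_num) hm
      linarith [hKspec n t, hKspec m t]

end JointMeasurability

/-! ### Time integration of the potential and the obstacle problem -/

section TimeIntegral

theorem absolutelyContinuousOnInterval_clm_comp {E F : Type*} [NormedAddCommGroup E]
    [NormedSpace ℝ E] [NormedAddCommGroup F] [NormedSpace ℝ F] (L : E →L[ℝ] F) {y : ℝ → E}
    {a b : ℝ} (hy : AbsolutelyContinuousOnInterval y a b) :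
    AbsolutelyContinuousOnInterval (fun t => L (y t)) a b := by
  have h := Tendsto.const_mul ‖L‖ hy
  rw [mul_zero] at h
  refine squeeze_zero (fun _ => Finset.sum_nonneg fun _ _ => dist_nonneg) (fun E => ?_) h
  rw [Finset.mul_sum]
  exact Finset.sum_le_sum fun i _ => L.dist_le_opNorm _ _

theorem ae_prod_of_ae_ae {α β : Type*} [MeasurableSpace α] [MeasurableSpace β] {μ : Measure α}
    {ν : Measure β} [SFinite ν] {v : α × β → ℝ} (hv : AEStronglyMeasurable v (μ.prod ν)) {s : ℝ}
    (h : ∀ᵐ a ∂μ, ∀ᵐ b ∂ν, |v (a, b)| ≤ s) : ∀ᵐ p ∂(μ.prod ν), |v p| ≤ s := by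
  -- Exchanging the quantifiers requires a measurable set, so a strongly measurable version of `v`
  -- is used.
  have hm : MeasurableSet {p | |hv.mk v p| ≤ s} :=
    hv.stronglyMeasurable_mk.measurable.abs measurableSet_Iic
  have h1 : ∀ᵐ p ∂(μ.prod ν), |hv.mk v p| ≤ s := by
    rw [Measure.ae_prod_iff_ae_ae hm]
    filter_upwards [h, Measure.ae_ae_of_ae_prod hv.ae_eq_mk] with a h1 h2
    filter_upwards [h1, h2] with b h3 h4
    rwa [← h4]
  filter_upwards [h1, hv.ae_eq_mk] with p h2 h3
  rwa [h3]

variable {N : ℕ} {A : Set (Euc N)}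

theorem IsPotential.integrable {u : ℝ → L2Vec A} {v : ℝ → Euc N → ℝ} (hv : IsPotential A u v)
    {t : ℝ} {S : Set (Euc N)} (hS : volume.restrict A S < ⊤) :
    Integrable (Function.uncurry v)
      ((volume.restrict (Ioc 0 t)).prod ((volume.restrict A).restrict S)) := by
  have hm : AEStronglyMeasurable (Function.uncurry v)
      ((volume.restrict (Ioc 0 t)).prod ((volume.restrict A).restrict S)) :=
    hv.measurable.mono_ac (Measure.AbsolutelyContinuous.prod
      (Measure.restrict_mono Ioc_subset_Ioi_self le_rfl).absolutelyContinuous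
      Measure.restrict_le_self.absolutelyContinuous)
  have : IsFiniteMeasure ((volume.restrict A).restrict S) := ⟨by simpa using hS⟩
  refine Integrable.of_bound hm 1 (ae_prod_of_ae_ae hm ?_)
  filter_upwards [ae_restrict_of_ae_restrict_of_subset Ioc_subset_Ioi_self hv.equation]
    with s hs
  exact ae_restrict_of_ae hs.1

/-- It suffices to integrate over sets `S` of finite measure. With `L g = ∫_S T g`, the scalar
function `L ∘ u` is absolutely continuous away from `0` with derivative `∫_S v(s)` a.e.; integrate
from `ε`, let `ε → 0`, and apply Fubini. -/
theorem IsPotential.inverse_gradient_ae_eq {u₀ : L2Vec A} {u : ℝ → L2Vec A}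
    (hu : IsGradientFlow A u₀ u) {v : ℝ → Euc N → ℝ} (hv : IsPotential A u v)
    {T : L2Vec A →L[ℝ] L2 A} (hT : ∀ q ∈ closure (testGraph A), T q.2 = q.1) {t : ℝ}
    (ht : 0 ≤ t) : T (u t - u₀) =ᵐ[volume.restrict A] timeIntegral v t := by
  have hti : timeIntegral v t = fun x => ∫ s in Ioc 0 t, v s x := by
    ext x; exact intervalIntegral.integral_of_le ht
  refine ae_eq_of_forall_setIntegral_eq_of_sigmaFinite (fun S hS hSf => ?_) (fun S hS hSf => ?_)
    fun S hS hSf => ?_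
  · have : IsFiniteMeasure ((volume.restrict A).restrict S) := ⟨by simpa using hSf⟩
    exact ((Lp.memLp (T (u t - u₀))).restrict S).integrable (by simp)
  · rw [hti]
    exact (hv.integrable hSf).integral_prod_right
  have hint := hv.integrable (t := t) hSf
  rw [hti, ← integral_integral_swap hint]
  set L : L2Vec A →L[ℝ] ℝ :=
    (innerSL ℝ (indicatorConstLp 2 hS hSf.ne (1 : ℝ))).comp T with hL
  have hLe : ∀ g, L g = ∫ x in S, T g x ∂(volume.restrict A) := fun g =>
    L2.inner_indicatorConstLp_one hS hSf.ne (T g)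
  rw [← hLe, map_sub, ← hu.initial]
  rcases ht.eq_or_lt with rfl | ht
  · simp
  have hderiv : ∀ᵐ s ∂(volume.restrict (Ioi (0 : ℝ))),
      deriv (fun s => L (u s)) s = ∫ x in S, v s x ∂(volume.restrict A) := by
    filter_upwards [hv.equation] with s ⟨_, g, ⟨f, hf, hfg⟩, hg, _⟩
    have hd : HasDerivAt (fun s => L (u s)) (L g) s := L.hasFDerivAt.comp_hasDerivAt s hg
    rw [hd.deriv, hLe, hT _ hfg]
    exact integral_congr_ae (ae_restrict_of_ae hf)
  have hII : IntegrableOn (fun s => ∫ x in S, v s x ∂(volume.restrict A)) (Ioc 0 t) :=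
    hint.integral_prod_left
  have hftc : ∀ ε ∈ Ioc 0 t, ∫ s in ε..t, ∫ x in S, v s x ∂(volume.restrict A) =
      L (u t) - L (u ε) := by
    intro ε hε
    rw [← (absolutelyContinuousOnInterval_clm_comp L
      (hu.absCont ε t hε.1 hε.2)).integral_deriv_eq_sub, intervalIntegral.integral_of_le hε.2,
      intervalIntegral.integral_of_le hε.2]
    refine integral_congr_ae ?_
    have hsub : Ioc ε t ⊆ Ioi 0 := fun s hs => hε.1.trans hs.1
    filter_upwards [ae_restrict_of_ae_restrict_of_subset hsub hderiv] with s hs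
    exact hs.symm
  have hlim1 : Tendsto (fun ε => ∫ s in ε..t, ∫ x in S, v s x ∂(volume.restrict A)) (𝓝[>] 0)
      (𝓝 (∫ s in (0 : ℝ)..t, ∫ x in S, v s x ∂(volume.restrict A))) := by
    have hc := intervalIntegral.continuousOn_primitive_interval_left (μ := volume) (a := 0) (b := t)
      (f := fun s => ∫ x in S, v s x ∂(volume.restrict A))
      (by rw [uIcc_of_le ht.le, integrableOn_Icc_iff_integrableOn_Ioc]; exact hII)
    have h0 := hc 0 left_mem_uIcc
    rw [uIcc_of_le ht.le] at h0
    refine h0.mono_left ?_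
    rw [← nhdsWithin_Ioc_eq_nhdsGT ht]
    exact nhdsWithin_mono _ Ioc_subset_Icc_self
  have hlim2 : Tendsto (fun ε => L (u t) - L (u ε)) (𝓝[>] 0) (𝓝 (L (u t) - L (u 0))) := by
    refine tendsto_const_nhds.sub ((L.continuous.tendsto _).comp ?_)
    exact (hu.continuousOn 0 self_mem_Ici).mono_left (nhdsWithin_mono _ Ioi_subset_Ici_self)
  rw [← intervalIntegral.integral_of_le ht.le]
  refine tendsto_nhds_unique (hlim2.congr' ?_) hlim1
  filter_upwards [Ioc_mem_nhdsGT ht] with ε hε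
  exact (hftc ε hε).symm

theorem IsGradientFlow.exists_isPotential {u₀ : L2Vec A} {u : ℝ → L2Vec A}
    (hu : IsGradientFlow A u₀ u) (hP : PoincareOn A) : ∃ v, IsPotential A u v := by
  obtain ⟨T, hT⟩ := hP.exists_inverse_gradient
  have : Fact ((2 : ENNReal) ≠ ⊤) := ⟨by simp⟩
  obtain ⟨v, hv, hvF⟩ := exists_jointly_stronglyMeasurable (F := fun t => T (deriv u t))
    (T.continuous.comp_stronglyMeasurable (stronglyMeasurable_deriv u))
  refine ⟨v, hv.aestronglyMeasurable, ?_⟩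
  filter_upwards [hu.inclusion] with t ⟨p, hp, hd⟩
  have hp := mem_face_of_mem_subgrad hp
  have hmem : -p ∈ (1 : ℝ) • gradBall A := by
    rw [one_smul]; exact neg_mem_gradBall hp.1
  obtain ⟨h1, h2⟩ := inverse_gradient_mem_of_mem_smul hT zero_le_one hmem
  have hvt := hvF t
  rw [hd.deriv] at hvt
  refine ⟨?_, -p, ⟨T (-p), hvt.symm, h1⟩, hd, ?_⟩
  · filter_upwards [h2, hvt] with x h3 h4
    rwa [h4]
  · rw [divMass_eq_of_mem_face hp, ← L2.inner_def, ← EReal.coe_add, inner_neg_right,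
      real_inner_comm, add_neg_cancel, EReal.coe_zero]

theorem IsPotential.solvesObstacle (hA : IsOpen A) (hP : PoincareOn A) {u₀ : L2Vec A}
    {G : ℝ → L2Vec A} (hG : IsProjCurve (gradBall A) u₀ G) {u : ℝ → L2Vec A}
    (hu : IsGradientFlow A u₀ u) {v : ℝ → Euc N → ℝ} (hv : IsPotential A u v) {t : ℝ}
    (ht : 0 ≤ t) (hut : u t = u₀ - G t) :
    SolvesObstacle A u₀ t (timeIntegral v t) (u t - u₀) := by
  obtain ⟨T, hT⟩ := hP.exists_inverse_gradient
  have hneg : ∀ g ∈ t • gradBall A, -g ∈ t • gradBall A := by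
    rintro _ ⟨k, hk, rfl⟩
    exact ⟨-k, neg_mem_gradBall hk, smul_neg t k⟩
  have hmem : u t - u₀ ∈ t • gradBall A := by
    rw [hut, sub_sub_cancel_left]; exact hneg _ (hG.mem t ht)
  obtain ⟨h1, h2⟩ := inverse_gradient_mem_of_mem_smul hT ht hmem
  have hw := hv.inverse_gradient_ae_eq hu hT ht
  refine ⟨⟨_, hw, h1⟩, ?_, fun z h hz hb => ?_⟩
  · filter_upwards [h2, hw] with x h3 h4
    rwa [← h4]
  -- `G t` is the projection of `u₀` on `t • K` while the obstacle energy is `‖u₀ + h‖ ^ 2 / 2`, so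
  -- the competitor is `-h`.
  · have hk := hneg _ (hz.mem_smul_gradBall hA ht hb)
    have hle := sq_norm_sub_le_of_proj (hG.var t ht) hk
    have e : ∀ g : L2Vec A, ∫ x in A, ‖u₀ x + g x‖ ^ 2 = ‖u₀ + g‖ ^ 2 := by
      intro g
      rw [norm_sq_eq_integral]
      refine integral_congr_ae ?_
      filter_upwards [Lp.coeFn_add u₀ g] with x hx
      rw [hx, Pi.add_apply]
    rw [e, e, add_sub_cancel, hut]
    rw [sub_neg_eq_add] at hle
    nlinarith [sq_nonneg ‖-h - G t‖]

end TimeIntegral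

end DivFlow

theorem mainTheorem1 {N : ℕ} (A : Set (Euc N)) (hA : IsOpen A) (u₀ : L2Vec A) :
    (∃ u : ℝ → L2Vec A, IsGradientFlow A u₀ u) ∧
    ∀ u : ℝ → L2Vec A, IsGradientFlow A u₀ u →
      (∀ t : ℝ, 0 < t → ∀ z : L2Vec A, IsMinOn (proxEnergy A u₀ t) univ z ↔ z = u t) ∧
      (PoincareOn A →
        (∃ v : ℝ → Euc N → ℝ, IsPotential A u v) ∧
        ∀ v : ℝ → Euc N → ℝ, IsPotential A u v →
          ∀ t : ℝ, 0 ≤ t → ∃ g : L2Vec A,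
            u t = u₀ + g ∧ SolvesObstacle A u₀ t (timeIntegral v t) g) := by
  obtain ⟨G, hG⟩ := exists_isProjCurve isClosed_gradBall convex_gradBall zero_mem_gradBall
    hasClampProperty_gradBall u₀
  have hflow := hG.isGradientFlow hA
  refine ⟨⟨_, hflow⟩, fun u hu => ?_⟩
  have hut : ∀ t, 0 ≤ t → u t = u₀ - G t := fun t ht => hu.eq hflow ht
  refine ⟨fun t ht z => ?_, fun hP => ⟨hu.exists_isPotential hP, fun v hv t ht =>
    ⟨u t - u₀, by abel, hv.solvesObstacle hA hP hG hu ht (hut t ht)⟩⟩⟩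
  obtain ⟨p, hp, hpt⟩ := hG.exists_smul_eq convex_gradBall ht
  rw [hut t ht.le]
  exact isMinOn_proxEnergy_iff ht hp (by rw [hpt, sub_sub_cancel]) z
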